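/- Let $k$ be a field of characteristic $0$. All graded objects are $\mathbb Z$-graded with cohomological grading, and "free", "complete" are understood degreewise. For a graded Lie algebra $\mathfrak g$ let $F_n\mathfrak g$ be the span of all iterated brackets of at least $n$ elements; $\mathfrak g$ is complete if $\mathfrak g\to\varprojlim_n \mathfrak g/F_n\mathfrak g$ is an isomorphism. $\widehat{Lie}(V)$ denotes the free complete graded Lie algebra on a finite dimensional graded vector space $V$. A Maurer–Cartan element of a dg Lie algebra is an element $\alpha$ of degree $1$ with $d\alpha+\tfrac12[\alpha,\alpha]=0$. In a complete dg Lie algebra, an element $\lambda$ of degree $0$ is a gauge from $\alpha_0$ to $\alpha_1$ if the solution $\alpha(t)\in\varprojlim_n(\mathfrak g/F_n\mathfrak g)[t]$ of $\dot\alpha(t)=d\lambda-[\lambda,\alpha(t)]$, $\alpha(0)=\alpha_0$, satisfies $\alpha(1)=\alpha_1$. Let $\Omega_0=k$ and $\Omega_1=k[t_0,t_1,dt_0,dt_1]/(t_0+t_1-1,\ dt_0+dt_1)$ be the commutative dg algebras of polynomial differential forms on the point and on the interval. Let $C_0=k$ and let $C_1\subset\Omega_1$ be the subcomplex spanned by $\omega_0=t_0$,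 $\omega_1=t_1$, $\omega_{01}=t_0\,dt_1-t_1\,dt_0$. Let $(i_n,p_n,h_n)$ be Dupont's contraction of $\Omega_n$ onto $C_n$: for $n=0$ both $i_0,p_0$ are identities and $h_0=0$; for $n=1$, with $t=t_1$, $i_1$ is the inclusion, $p_1(f+g\,dt)=f(0)\,\omega_0+f(1)\,\omega_1+\big(\int_0^1 g\big)\,\omega_{01}$ and $h_1(f+g\,dt)=\int_0^t g-t\int_0^1 g$. Transferring the commutative algebra structure of $\Omega_n$ along this contraction (sum over binary trees) gives a $\mathcal C_\infty$-algebra structure on $C_n$, and $\mathfrak{mc}_n$ is the complete cobar construction of the dual coalgebra: $\mathfrak{mc}_n=\widehat{Lie}(sC_n^\vee)$, with generators $x_i=s e_i^\vee$ of degree $1-|e_i|$ dual to the basis $(e_i)$ of $C_n$, and with $d$ the unique derivation of degree $1$ such that the element $\kappa=\sum_i x_i\otimes e_i$ satisfies $$\sum_i dx_i\otimes e_i+(1\otimes d_{C_n})\kappa+(1\otimes p_n)\big(\tfrac12[\psi,\psi]\big)=0,\qquad \psi=(1\otimes i_n)\kappa-(1\otimes h_n)\big(\tfrac12[\psi,\psi]\big),$$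 where $\psi$ is the solution, obtained by iteration, in the completed tensor product of $\mathfrak{mc}_n$ and $\Omega_n$. Then: 1. $\mathfrak{mc}_0$ is the free complete dg Lie algebra on a single Maurer–Cartan generator: $d^2=0$, it is free as a complete graded Lie algebra on the element $\alpha=s1^\vee$ of degree $1$, and $\alpha$ is a Maurer–Cartan element. For any complete dg Lie algebra $L$ which is free as a complete graded Lie algebra on a single Maurer–Cartan element $a$, there is an isomorphism of dg Lie algebras $\mathfrak{mc}_0\cong L$ mapping $\alpha$ to $a$. 2. $\mathfrak{mc}_1$ is the Lawrence–Sullivan algebra: $d^2=0$, it is free as a complete graded Lie algebra on $\alpha_0=s\omega_0^\vee$, $\alpha_1=s\omega_1^\vee$ of degree $1$ and $\lambda=s\omega_{01}^\vee$ of degree $0$, the elements $\alpha_0,\alpha_1$ are Maurer–Cartan elements, and $\lambda$ is a gauge from $\alpha_0$ to $\alpha_1$. For any complete dg Lie algebra $L$ which is free as a complete graded Lie algebra on two Maurer–Cartan elements $a,b$ of degree $1$ and an element $x$ of degree $0$ which is a gauge from $a$ to $b$, there is an isomorphism of dg Lie algebras $\mathfrak{mc}_1\cong L$ mapping $\alpha_0,\alpha_1,\lambda$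 to $a,b,x$. -/

import Mathlib

universe u

namespace LieMC

/-! ## Graded Lie algebras -/

/-- The sign `(-1)^n` as a scalar. -/
def sgn (k : Type u) [Field k] (n : ℤ) : k := ((Int.negOnePow n : ℤ) : k)

theorem sgn_add (k : Type u) [Field k] (m n : ℤ) : sgn k (m + n) = sgn k m * sgn k n := by
  simp [sgn, Int.negOnePow_add]

theorem sgn_eq (k : Type u) [Field k] (n : ℤ) : sgn k n = 1 ∨ sgn k n = -1 := by
  rcases Int.even_or_odd n with h | h
  · left; simp [sgn, Int.negOnePow_even n h]
  · right; simp [sgn, Int.negOnePow_odd n h]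

theorem sgn_mul_self (k : Type u) [Field k] (n : ℤ) : sgn k n * sgn k n = 1 := by
  rcases sgn_eq k n with h | h <;> simp [h]

@[simp] theorem sgn_one (k : Type u) [Field k] : sgn k 1 = -1 := by simp [sgn]

@[simp] theorem sgn_zero (k : Type u) [Field k] : sgn k 0 = 1 := by simp [sgn]

/-- A `ℤ`-graded Lie algebra over `k` (used in characteristic `0`), given by its homogeneous
components. The degree of a bracket is carried as an equation `p + q = r`, which avoids casts. -/
structure GradedLie (k : Type u) [Field k] where
  /-- the homogeneous components -/
  V : ℤ → Type u
  [addCommGroup : ∀ p, AddCommGroup (V p)]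
  [module : ∀ p, Module k (V p)]
  /-- the bracket -/
  bracket : ∀ {p q r : ℤ}, p + q = r → V p →ₗ[k] V q →ₗ[k] V r
  antisymm : ∀ {p q r : ℤ} (h : p + q = r) (h' : q + p = r) (x : V p) (y : V q),
    bracket h x y = -(sgn k (p * q) • bracket h' y x)
  jacobi : ∀ {p q r qr pq pr t : ℤ} (h₁ : q + r = qr) (h₂ : p + qr = t) (h₃ : p + q = pq)
    (h₄ : pq + r = t) (h₅ : p + r = pr) (h₆ : q + pr = t) (x : V p) (y : V q) (z : V r),
    bracket h₂ x (bracket h₁ y z) =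
      bracket h₄ (bracket h₃ x y) z + sgn k (p * q) • bracket h₆ y (bracket h₅ x z)

attribute [instance] GradedLie.addCommGroup GradedLie.module

namespace GradedLie

variable {k : Type u} [Field k]

/-- `L.IsBracketing n x` : the element `x` is obtained as an iterated bracketing (in any
arrangement) of `n ≥ 1` homogeneous elements of `L`. -/
inductive IsBracketing (L : GradedLie k) : ℕ → ∀ {p : ℤ}, L.V p → Prop
  | elem {p : ℤ} (x : L.V p) : IsBracketing L 1 x
  | bracket {m n : ℕ} {p q r : ℤ} (h : p + q = r) {x : L.V p} {y : L.V q}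
      (hx : IsBracketing L m x) (hy : IsBracketing L n y) :
      IsBracketing L (m + n) (L.bracket h x y)

/-- The degree `p` part of the canonical filtration `F_n L`: the span of all bracketings of at
least `n` elements. -/
def F (L : GradedLie k) (n : ℕ) (p : ℤ) : Submodule k (L.V p) :=
  Submodule.span k {x | ∃ m, n ≤ m ∧ L.IsBracketing m x}

/-- `L` is complete: the canonical map `L → lim_n L / F_n L` is injective and surjective in every
degree. A point of the limit is represented by a sequence whose consecutive terms agree
modulo `F_n L`. -/
def IsComplete (L : GradedLie k) : Prop :=
  ∀ p : ℤ, (∀ x : L.V p, (∀ n, x ∈ L.F n p) → x = 0) ∧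
    ∀ s : ℕ → L.V p, (∀ n, s (n + 1) - s n ∈ L.F n p) → ∃ x, ∀ n, x - s n ∈ L.F n p

/-- Morphisms of graded Lie algebras (of degree `0`). -/
@[ext] structure Hom (L M : GradedLie k) where
  /-- the components -/
  f : ∀ p, L.V p →ₗ[k] M.V p
  map_bracket : ∀ {p q r : ℤ} (h : p + q = r) (x : L.V p) (y : L.V q),
    f r (L.bracket h x y) = M.bracket h (f p x) (f q y)

/-- `L` is the free complete graded Lie algebra on the homogeneous elements `g i` of degree
`deg i`: it is complete, and every assignment of the `g i` to elements of the same degrees in a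
complete graded Lie algebra extends uniquely to a morphism. -/
def IsFreeCompleteOn (L : GradedLie k) {I : Type} (deg : I → ℤ) (g : ∀ i, L.V (deg i)) : Prop :=
  L.IsComplete ∧ ∀ (M : GradedLie k), M.IsComplete → ∀ y : ∀ i, M.V (deg i),
    ∃! φ : Hom L M, ∀ i, φ.f (deg i) (g i) = y i

end GradedLie

/-- A graded Lie algebra with a derivation of degree `1`. -/
structure DerLie (k : Type u) [Field k] extends GradedLie k where
  /-- the derivation -/
  d : ∀ {p q : ℤ}, p + 1 = q → V p →ₗ[k] V q
  leibniz : ∀ {p q r p' q' t : ℤ} (h : p + q = r) (hr : r + 1 = t) (hp : p + 1 = p')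
    (h₁ : p' + q = t) (hq : q + 1 = q') (h₂ : p + q' = t) (x : V p) (y : V q),
    d hr (bracket h x y) = bracket h₁ (d hp x) y + sgn k p • bracket h₂ x (d hq y)

namespace DerLie

variable {k : Type u} [Field k]

/-- `L` is a dg Lie algebra: its derivation squares to zero. -/
def IsDGLie (L : DerLie k) : Prop :=
  ∀ {p q r : ℤ} (h : p + 1 = q) (h' : q + 1 = r) (x : L.V p), L.d h' (L.d h x) = 0

/-- Isomorphisms: bijective morphisms of graded Lie algebras that commute with the
differentials. -/
structure Iso (L M : DerLie k) extends GradedLie.Hom L.toGradedLie M.toGradedLie where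
  bijective : ∀ p, Function.Bijective (f p)
  map_d : ∀ {p q : ℤ} (h : p + 1 = q) (x : L.V p), f q (L.d h x) = M.d h (f p x)

/-- Maurer--Cartan elements: `dα + ½[α, α] = 0` with `α` of degree `1`. -/
def IsMaurerCartan (L : DerLie k) (α : L.V 1) : Prop :=
  L.d (q := 2) (by norm_num) α + (2 : k)⁻¹ • L.bracket (r := 2) (by norm_num) α α = 0

/-- The degree `0` element `x` is a gauge from `a` to `b`: the flow
`α'(t) = dx - [x, α(t)] = dx + [α(t), x]`, `α(0) = a`, satisfies `α(1) = b`.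
Here `α(t) = ∑ₙ cₙ tⁿ` is a power series whose coefficients tend to zero for the canonical
filtration, i.e. an element of `lim_N (L / F_N L)[t]`, and `α(1) = ∑ₙ cₙ`. -/
def IsGauge (L : DerLie k) (x : L.V 0) (a b : L.V 1) : Prop :=
  ∃ c : ℕ → L.V 1, c 0 = a ∧
    (∀ n : ℕ, ((n + 1 : ℕ) : k) • c (n + 1) =
      (if n = 0 then L.d (by norm_num) x else 0) - L.bracket (by norm_num) x (c n)) ∧
    (∀ N : ℕ, ∃ K : ℕ, ∀ n ≥ K, c n ∈ L.F N 1) ∧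
    (∀ N : ℕ, ∃ K : ℕ, ∀ n ≥ K, (∑ m ∈ Finset.range n, c m) - b ∈ L.F N 1)

/-- `L` is a complete dg Lie algebra, free as a complete graded Lie algebra on the single
element `a` of degree `1`, and `a` is a Maurer--Cartan element. -/
def IsFreeOnMaurerCartan (L : DerLie k) (a : L.V 1) : Prop :=
  L.IsDGLie ∧ L.IsFreeCompleteOn (I := Unit) (fun _ => 1) (fun _ => a) ∧ L.IsMaurerCartan a

/-- The three generators of a Lawrence--Sullivan algebra. -/
inductive LSGen
  | a | b | x

/-- The degrees of the three generators. -/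
def LSGen.deg : LSGen → ℤ
  | .a => 1
  | .b => 1
  | .x => 0

/-- The three elements `a`, `b`, `x` as a family. -/
def lsFamily (L : DerLie k) (a b : L.V 1) (x : L.V 0) : ∀ i : LSGen, L.V i.deg
  | .a => a
  | .b => b
  | .x => x

/-- `L` is a Lawrence--Sullivan algebra with generators `a`, `b`, `x`: a complete dg Lie algebra,
free as a complete graded Lie algebra on `a`, `b` of degree `1` and `x` of degree `0`, such that
`a` and `b` are Maurer--Cartan elements and `x` is a gauge from `a` to `b`. -/
def IsLawrenceSullivan (L : DerLie k) (a b : L.V 1) (x : L.V 0) : Prop :=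
  L.IsDGLie ∧ L.IsFreeCompleteOn LSGen.deg (L.lsFamily a b x) ∧
    L.IsMaurerCartan a ∧ L.IsMaurerCartan b ∧ L.IsGauge x a b

end DerLie

/-! ## The free complete graded Lie algebra with a derivation

Noncommutative power series in the generators are represented as power series in an auxiliary
variable counting the word length, with coefficients in the free associative algebra. -/

section Free

variable {k : Type u} [Field k] {I : Type} (deg : I → ℤ)

/-- The total degree of a bracketing of generators. -/
def treeDeg : FreeMagma I → ℤ
  | .of i => deg i
  | .mul s t => treeDeg s + treeDeg t

@[simp] theorem treeDeg_of (i : I) : treeDeg deg (.of i) = deg i := rfl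

@[simp] theorem treeDeg_mul (s t : FreeMagma I) :
    treeDeg deg (s * t) = treeDeg deg s + treeDeg deg t := rfl

variable (k) in
/-- The value of a bracketing of generators in the free associative algebra, for the graded
commutator. -/
def treeLie : FreeMagma I → FreeAlgebra k I
  | .of i => FreeAlgebra.ι k i
  | .mul s t => treeLie s * treeLie t -
      sgn k (treeDeg deg s * treeDeg deg t) • (treeLie t * treeLie s)

@[simp] theorem treeLie_of (i : I) : treeLie k deg (.of i) = FreeAlgebra.ι k i := rfl

@[simp] theorem treeLie_mul (s t : FreeMagma I) :
    treeLie k deg (s * t) = treeLie k deg s * treeLie k deg t -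
      sgn k (treeDeg deg s * treeDeg deg t) • (treeLie k deg t * treeLie k deg s) := rfl

variable (k) in
/-- The Lie polynomials of word length `n` and degree `p`: the span of the bracketings of `n`
generators of total degree `p`. -/
def liePoly (n : ℕ) (p : ℤ) : Submodule k (FreeAlgebra k I) :=
  Submodule.span k {a | ∃ t : FreeMagma I, t.length = n ∧ treeDeg deg t = p ∧ treeLie k deg t = a}

theorem liePoly_zero (p : ℤ) : liePoly k deg 0 p = ⊥ := by
  rw [liePoly, Submodule.span_eq_bot]
  rintro a ⟨t, h, -, -⟩
  exact absurd h t.length_pos.ne'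

theorem liePoly_bracket {n m : ℕ} {p q : ℤ} {a b : FreeAlgebra k I}
    (ha : a ∈ liePoly k deg n p) (hb : b ∈ liePoly k deg m q) :
    a * b - sgn k (p * q) • (b * a) ∈ liePoly k deg (n + m) (p + q) := by
  induction ha using Submodule.span_induction with
  | zero => simp
  | add x y _ _ hx hy =>
    have : (x + y) * b - sgn k (p * q) • (b * (x + y)) =
      (x * b - sgn k (p * q) • (b * x)) + (y * b - sgn k (p * q) • (b * y)) := by
      rw [add_mul, mul_add, smul_add]; abel
    rw [this]; exact add_mem hx hy
  | smul c x _ hx =>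
    have : (c • x) * b - sgn k (p * q) • (b * (c • x)) =
      c • (x * b - sgn k (p * q) • (b * x)) := by
      rw [smul_mul_assoc, mul_smul_comm, smul_sub, smul_comm c]
    rw [this]; exact Submodule.smul_mem _ _ hx
  | mem x hx =>
    obtain ⟨s, rfl, rfl, rfl⟩ := hx
    induction hb using Submodule.span_induction with
    | zero => simp
    | add y z _ _ hy hz =>
      have : treeLie k deg s * (y + z) - sgn k (treeDeg deg s * q) • ((y + z) * treeLie k deg s) =
        (treeLie k deg s * y - sgn k (treeDeg deg s * q) • (y * treeLie k deg s)) +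
        (treeLie k deg s * z - sgn k (treeDeg deg s * q) • (z * treeLie k deg s)) := by
        rw [add_mul, mul_add, smul_add]; abel
      rw [this]; exact add_mem hy hz
    | smul c y _ hy =>
      have : treeLie k deg s * (c • y) - sgn k (treeDeg deg s * q) • ((c • y) * treeLie k deg s) =
        c • (treeLie k deg s * y - sgn k (treeDeg deg s * q) • (y * treeLie k deg s)) := by
        rw [smul_mul_assoc, mul_smul_comm, smul_sub, smul_comm c]
      rw [this]; exact Submodule.smul_mem _ _ hy
    | mem y hy =>
      obtain ⟨t, rfl, rfl, rfl⟩ := hy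
      exact Submodule.subset_span ⟨s * t, rfl, rfl, rfl⟩

variable (k) in
/-- The degree `p` component of the free complete graded Lie algebra: the product over all `n` of
the Lie polynomials of length `n` and degree `p`. -/
def lieHat (p : ℤ) : Submodule k (PowerSeries (FreeAlgebra k I)) where
  carrier := {F | ∀ n, PowerSeries.coeff n F ∈ liePoly k deg n p}
  zero_mem' n := by simp
  add_mem' hF hG n := by rw [map_add]; exact add_mem (hF n) (hG n)
  smul_mem' c F hF n := Submodule.smul_mem _ c (hF n)

theorem mem_lieHat {p : ℤ} {F : PowerSeries (FreeAlgebra k I)} :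
    F ∈ lieHat k deg p ↔ ∀ n, PowerSeries.coeff n F ∈ liePoly k deg n p := Iff.rfl

theorem coeff_smul' (c : k) (n : ℕ) (F : PowerSeries (FreeAlgebra k I)) :
    PowerSeries.coeff n (c • F) = c • PowerSeries.coeff n F := rfl

theorem lieHat_bracket {p q : ℤ} {F G : PowerSeries (FreeAlgebra k I)}
    (hF : F ∈ lieHat k deg p) (hG : G ∈ lieHat k deg q) :
    F * G - sgn k (p * q) • (G * F) ∈ lieHat k deg (p + q) := by
  intro n
  rw [map_sub, coeff_smul', PowerSeries.coeff_mul, PowerSeries.coeff_mul,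
    ← Finset.Nat.sum_antidiagonal_swap, Finset.smul_sum, ← Finset.sum_sub_distrib]
  refine Submodule.sum_mem _ fun ij hij => ?_
  obtain rfl := Finset.HasAntidiagonal.mem_antidiagonal.1 hij
  have := liePoly_bracket deg (hF ij.2) (hG ij.1)
  rw [add_comm ij.2 ij.1] at this
  exact this

variable (k) in
/-- The free complete graded Lie algebra on generators of degrees `deg i`, inside the
noncommutative power series with the graded commutator. -/
noncomputable def freeLie : GradedLie k where
  V p := lieHat k deg p
  bracket {p q r} h := LinearMap.mk₂ k
    (fun F G => ⟨F.1 * G.1 - sgn k (p * q) • (G.1 * F.1), h ▸ lieHat_bracket deg F.2 G.2⟩)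
    (fun F F' G => Subtype.ext <| by
      simp only [Submodule.coe_add, add_mul, mul_add, smul_add]; abel)
    (fun c F G => Subtype.ext <| by
      simp only [Submodule.coe_smul, smul_mul_assoc, mul_smul_comm, smul_sub]
      rw [smul_comm c])
    (fun F G G' => Subtype.ext <| by
      simp only [Submodule.coe_add, add_mul, mul_add, smul_add]; abel)
    (fun c F G => Subtype.ext <| by
      simp only [Submodule.coe_smul, smul_mul_assoc, mul_smul_comm, smul_sub]
      rw [smul_comm c])
  antisymm {p q r} h h' F G := Subtype.ext <| by
    simp only [LinearMap.mk₂_apply, Submodule.coe_neg, Submodule.coe_smul, mul_comm q p, smul_sub,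
      smul_smul, sgn_mul_self, one_smul]
    abel
  jacobi {p q r qr pq pr t} h₁ h₂ h₃ h₄ h₅ h₆ F G H := Subtype.ext <| by
    subst h₁ h₃ h₅
    simp only [LinearMap.mk₂_apply, Submodule.coe_add, Submodule.coe_smul, mul_add, add_mul,
      sgn_add, mul_comm q p]
    rcases sgn_eq k (p * q) with h | h <;> rcases sgn_eq k (p * r) with h' | h' <;>
      rcases sgn_eq k (q * r) with h'' | h'' <;> simp only [h, h', h'', one_smul, neg_smul,
      mul_one, mul_neg, neg_neg] <;> noncomm_ring

variable (k) in
/-- The `i`-th generator. -/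
noncomputable def lieGen (i : I) : (freeLie k deg).V (deg i) :=
  ⟨PowerSeries.monomial 1 (FreeAlgebra.ι k i), fun n => by
    rw [PowerSeries.coeff_monomial]
    split_ifs with h
    · subst h; exact Submodule.subset_span ⟨.of i, rfl, rfl, rfl⟩
    · exact zero_mem _⟩

/-- The algebra map `x_i ↦ !![(-1)^|x_i| x_i, D_i; 0, x_i]`. Its upper right entry is the signed
derivation with values in power series that sends `x_i` to `D_i`. -/
noncomputable def derMatrix (D : I → PowerSeries (FreeAlgebra k I)) :
    FreeAlgebra k I →ₐ[k] Matrix (Fin 2) (Fin 2) (PowerSeries (FreeAlgebra k I)) :=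
  FreeAlgebra.lift k fun i =>
    !![sgn k (deg i) • PowerSeries.monomial 1 (FreeAlgebra.ι k i), D i;
       0, PowerSeries.monomial 1 (FreeAlgebra.ι k i)]

/-- The signed derivation `x_i ↦ D_i` on noncommutative polynomials. -/
noncomputable def derPoly (D : I → PowerSeries (FreeAlgebra k I)) :
    FreeAlgebra k I →ₗ[k] PowerSeries (FreeAlgebra k I) where
  toFun a := derMatrix deg D a 0 1
  map_add' a b := by rw [map_add]; rfl
  map_smul' c a := by rw [map_smul]; rfl

/-- The signed derivation `x_i ↦ D_i` on noncommutative power series, applied to the components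
of each word length. It does not decrease word length when the `D_i` have no constant term, so
only the components of length at most `m` contribute to length `m`. -/
noncomputable def derSeries (D : I → PowerSeries (FreeAlgebra k I))
    (F : PowerSeries (FreeAlgebra k I)) : PowerSeries (FreeAlgebra k I) :=
  PowerSeries.mk fun m => ∑ n ∈ Finset.range (m + 1),
    PowerSeries.coeff m (derPoly deg D (PowerSeries.coeff n F))

theorem coeff_mon_ne {m n : ℕ} (h : m ≠ n) (a : FreeAlgebra k I) :
    PowerSeries.coeff m (PowerSeries.monomial n a) = 0 := by
  rw [PowerSeries.coeff_monomial, if_neg h]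

theorem smul_monomial (c : k) (n : ℕ) (a : FreeAlgebra k I) :
    c • PowerSeries.monomial n a = PowerSeries.monomial n (c • a) := by
  ext1 m
  rw [coeff_smul', PowerSeries.coeff_monomial, PowerSeries.coeff_monomial]
  split_ifs <;> simp

theorem derMatrix_of_mem (D : I → PowerSeries (FreeAlgebra k I)) {n : ℕ} {p : ℤ}
    {a : FreeAlgebra k I} (ha : a ∈ liePoly k deg n p) :
    derMatrix deg D a = !![sgn k p • PowerSeries.monomial n a, derPoly deg D a;
      0, PowerSeries.monomial n a] := by
  have tree : ∀ t : FreeMagma I, derMatrix deg D (treeLie k deg t) =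
      !![sgn k (treeDeg deg t) • PowerSeries.monomial t.length (treeLie k deg t),
        derPoly deg D (treeLie k deg t); 0,
        PowerSeries.monomial t.length (treeLie k deg t)] := by
    intro t
    induction t with
    | ih1 i =>
      have : derMatrix deg D (treeLie k deg (.of i)) =
        !![sgn k (deg i) • PowerSeries.monomial 1 (FreeAlgebra.ι k i), D i;
          0, PowerSeries.monomial 1 (FreeAlgebra.ι k i)] := by
        simp [derMatrix]
      have h2 : derPoly deg D (treeLie k deg (.of i)) = D i := by
        change derMatrix deg D (treeLie k deg (.of i)) 0 1 = D i
        rw [this]; rfl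
      rw [h2, this]; rfl
    | ih2 s t hs ht =>
      have key : derMatrix deg D (treeLie k deg (s * t)) =
          derMatrix deg D (treeLie k deg s) * derMatrix deg D (treeLie k deg t) -
          sgn k (treeDeg deg s * treeDeg deg t) •
          (derMatrix deg D (treeLie k deg t) * derMatrix deg D (treeLie k deg s)) := by
        simp
      have hl : (s * t).length = s.length + t.length := rfl
      have hm : PowerSeries.monomial (s * t).length (treeLie k deg (s * t)) =
          PowerSeries.monomial s.length (treeLie k deg s) *
            PowerSeries.monomial t.length (treeLie k deg t) -
          sgn k (treeDeg deg s * treeDeg deg t) •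
            (PowerSeries.monomial t.length (treeLie k deg t) *
            PowerSeries.monomial s.length (treeLie k deg s)) := by
        rw [PowerSeries.monomial_mul_monomial, PowerSeries.monomial_mul_monomial, smul_monomial,
          treeLie_mul, map_sub, hl, add_comm t.length]
      ext i j : 1
      fin_cases i <;> fin_cases j
      · simp only [key, hs, ht, hm]
        simp [sgn_add, smul_sub, smul_smul, mul_comm]
      · rfl
      · simp [hs, ht]
      · simp only [key, hs, ht, hm]
        simp
  induction ha using Submodule.span_induction with
  | zero => ext i j : 1; fin_cases i <;> fin_cases j <;> simp
  | mem x hx => obtain ⟨t, rfl, rfl, rfl⟩ := hx; exact tree t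
  | add x y _ _ hx hy =>
    rw [map_add, hx, hy]; ext i j : 1; fin_cases i <;> fin_cases j <;> simp
  | smul c x _ hx =>
    rw [map_smul, hx]
    ext i j : 1
    fin_cases i <;> fin_cases j <;> simp [smul_comm c]

theorem derPoly_mul (D : I → PowerSeries (FreeAlgebra k I)) {n m : ℕ} {p q : ℤ}
    {a b : FreeAlgebra k I} (ha : a ∈ liePoly k deg n p) (hb : b ∈ liePoly k deg m q) :
    derPoly deg D (a * b) = derPoly deg D a * PowerSeries.monomial m b +
      sgn k p • (PowerSeries.monomial n a * derPoly deg D b) := by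
  change derMatrix deg D (a * b) 0 1 = _
  rw [map_mul, derMatrix_of_mem deg D ha, derMatrix_of_mem deg D hb]
  simp [Matrix.mul_apply, Fin.sum_univ_two, add_comm]

theorem derPoly_ι (D : I → PowerSeries (FreeAlgebra k I)) (i : I) :
    derPoly deg D (FreeAlgebra.ι k i) = D i := by
  change derMatrix deg D (FreeAlgebra.ι k i) 0 1 = _
  simp [derMatrix]

theorem derPoly_mem {D : I → PowerSeries (FreeAlgebra k I)}
    (hD : ∀ i, D i ∈ lieHat k deg (deg i + 1)) {n : ℕ} {p : ℤ}
    {a : FreeAlgebra k I} (ha : a ∈ liePoly k deg n p) :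
    derPoly deg D a ∈ lieHat k deg (p + 1) ∧
      ∀ m < n, PowerSeries.coeff m (derPoly deg D a) = 0 := by
  induction ha using Submodule.span_induction with
  | zero => simp
  | add x y _ _ hx hy =>
    rw [map_add]
    exact ⟨add_mem hx.1 hy.1, fun m hm => by rw [map_add, hx.2 m hm, hy.2 m hm, add_zero]⟩
  | smul c x _ hx =>
    rw [map_smul]
    exact ⟨Submodule.smul_mem _ c hx.1, fun m hm => by rw [coeff_smul', hx.2 m hm, smul_zero]⟩
  | mem x hx =>
    obtain ⟨t, rfl, rfl, rfl⟩ := hx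
    induction t with
    | ih1 i =>
      rw [treeLie_of, derPoly_ι]
      refine ⟨hD i, fun m hm => ?_⟩
      have h0 : m = 0 := by
        have : (FreeMagma.of i).length = 1 := rfl
        omega
      have := hD i m
      rw [h0, liePoly_zero] at this
      rw [h0]; exact this
    | ih2 s t hs ht =>
      have ms : treeLie k deg s ∈ liePoly k deg s.length (treeDeg deg s) :=
        Submodule.subset_span ⟨s, rfl, rfl, rfl⟩
      have mt : treeLie k deg t ∈ liePoly k deg t.length (treeDeg deg t) :=
        Submodule.subset_span ⟨t, rfl, rfl, rfl⟩
      have hms : ∀ u : FreeMagma I, PowerSeries.monomial u.length (treeLie k deg u) ∈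
          lieHat k deg (treeDeg deg u) := fun u n => by
        rw [PowerSeries.coeff_monomial]
        split_ifs with h
        · subst h; exact Submodule.subset_span ⟨u, rfl, rfl, rfl⟩
        · exact zero_mem _
      have hl : (s * t).length = s.length + t.length := rfl
      rw [treeLie_mul, map_sub, map_smul, derPoly_mul deg D ms mt, derPoly_mul deg D mt ms]
      set δs := derPoly deg D (treeLie k deg s)
      set δt := derPoly deg D (treeLie k deg t)
      constructor
      · have e1 := lieHat_bracket deg hs.1 (hms t)
        have e2 := Submodule.smul_mem _ (sgn k (treeDeg deg s)) (lieHat_bracket deg (hms s) ht.1)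
        have e3 : treeDeg deg s + 1 + treeDeg deg t = treeDeg deg (s * t) + 1 := by
          rw [treeDeg_mul]; ring
        have e4 : treeDeg deg s + (treeDeg deg t + 1) = treeDeg deg (s * t) + 1 := by
          rw [treeDeg_mul]; ring
        rw [e3] at e1
        rw [e4] at e2
        convert add_mem e1 e2 using 1
        simp only [add_mul, mul_add, sgn_add, one_mul, mul_one]
        rcases sgn_eq k (treeDeg deg s * treeDeg deg t) with h | h <;>
          rcases sgn_eq k (treeDeg deg s) with h' | h' <;>
          rcases sgn_eq k (treeDeg deg t) with h'' | h'' <;>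
          simp only [h, h', h'', one_smul, neg_smul, mul_one, mul_neg, neg_neg] <;> noncomm_ring
      · intro m hm
        have z1 : ∀ (u v : FreeMagma I) (G : PowerSeries (FreeAlgebra k I)),
            (∀ m < u.length, PowerSeries.coeff m G = 0) → m < u.length + v.length →
            PowerSeries.coeff m (G * PowerSeries.monomial v.length (treeLie k deg v)) = 0 := by
          intro u v G hG hm
          rw [PowerSeries.coeff_mul]
          refine Finset.sum_eq_zero fun ij hij => ?_
          have := Finset.HasAntidiagonal.mem_antidiagonal.1 hij
          rw [PowerSeries.coeff_monomial]
          split_ifs with h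
          · rw [hG _ (by omega), zero_mul]
          · rw [mul_zero]
        have z2 : ∀ (u v : FreeMagma I) (G : PowerSeries (FreeAlgebra k I)),
            (∀ m < u.length, PowerSeries.coeff m G = 0) → m < u.length + v.length →
            PowerSeries.coeff m (PowerSeries.monomial v.length (treeLie k deg v) * G) = 0 := by
          intro u v G hG hm
          rw [PowerSeries.coeff_mul]
          refine Finset.sum_eq_zero fun ij hij => ?_
          have := Finset.HasAntidiagonal.mem_antidiagonal.1 hij
          rw [PowerSeries.coeff_monomial]
          split_ifs with h
          · rw [hG _ (by omega), mul_zero]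
          · rw [zero_mul]
        rw [hl] at hm
        simp only [map_sub, map_add, coeff_smul']
        rw [z1 s t δs hs.2 hm, z2 t s δt ht.2 (by omega), z1 t s δt ht.2 (by omega),
          z2 s t δs hs.2 hm]
        simp

theorem derSeries_mem {D : I → PowerSeries (FreeAlgebra k I)}
    (hD : ∀ i, D i ∈ lieHat k deg (deg i + 1)) {p : ℤ}
    {F : PowerSeries (FreeAlgebra k I)} (hF : F ∈ lieHat k deg p) :
    derSeries deg D F ∈ lieHat k deg (p + 1) := by
  intro m
  rw [derSeries, PowerSeries.coeff_mk]
  exact Submodule.sum_mem _ fun n _ => (derPoly_mem deg hD (hF n)).1 m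

theorem derSeries_mul (D : I → PowerSeries (FreeAlgebra k I)) {p q : ℤ}
    {F G : PowerSeries (FreeAlgebra k I)} (hF : F ∈ lieHat k deg p) (hG : G ∈ lieHat k deg q) :
    derSeries deg D (F * G) = derSeries deg D F * G + sgn k p • (F * derSeries deg D G) := by
  have sum_fst : ∀ (M : Type u) [AddCommMonoid M] (f : ℕ → ℕ → M) (m : ℕ),
      ∑ n ∈ Finset.range (m + 1), ∑ ab ∈ Finset.HasAntidiagonal.antidiagonal n, f ab.1 ab.2 =
      ∑ ib ∈ Finset.HasAntidiagonal.antidiagonal m,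
        ∑ a ∈ Finset.range (ib.1 + 1), f a ib.2 := by
    intro M _ f m
    rw [Finset.sum_sigma', Finset.sum_sigma']
    refine Finset.sum_bij' (fun x _ => ⟨(m - x.2.2, x.2.2), x.2.1⟩)
      (fun y _ => ⟨y.2 + y.1.2, (y.2, y.1.2)⟩) ?_ ?_ ?_ ?_ ?_
    · rintro ⟨n, a, b⟩ h; simp at h ⊢; omega
    · rintro ⟨⟨i, b⟩, a⟩ h; simp at h ⊢; omega
    · rintro ⟨n, a, b⟩ h; simp at h ⊢; omega
    · rintro ⟨⟨i, b⟩, a⟩ h; simp at h ⊢; omega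
    · rintro ⟨n, a, b⟩ h; rfl
  have coeff_mul_mon : ∀ (A : PowerSeries (FreeAlgebra k I)) (c : FreeAlgebra k I) (m b i : ℕ),
      i + b = m → PowerSeries.coeff m (A * PowerSeries.monomial b c) =
        PowerSeries.coeff i A * c := by
    rintro A c m b i rfl
    rw [PowerSeries.coeff_mul, Finset.sum_eq_single (i, b)]
    · rw [PowerSeries.coeff_monomial_same]
    · rintro ⟨x, y⟩ h hne
      have := Finset.HasAntidiagonal.mem_antidiagonal.1 h
      rw [coeff_mon_ne, mul_zero]
      rintro rfl
      exact hne (Prod.ext (by simp at this ⊢; omega) rfl)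
    · intro h; exact (h (Finset.HasAntidiagonal.mem_antidiagonal.2 rfl)).elim
  have coeff_mon_mul : ∀ (A : PowerSeries (FreeAlgebra k I)) (c : FreeAlgebra k I) (m a j : ℕ),
      a + j = m → PowerSeries.coeff m (PowerSeries.monomial a c * A) =
        c * PowerSeries.coeff j A := by
    rintro A c m a j rfl
    rw [PowerSeries.coeff_mul, Finset.sum_eq_single (a, j)]
    · rw [PowerSeries.coeff_monomial_same]
    · rintro ⟨x, y⟩ h hne
      have := Finset.HasAntidiagonal.mem_antidiagonal.1 h
      rw [coeff_mon_ne, zero_mul]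
      rintro rfl
      exact hne (Prod.ext rfl (by simp at this ⊢; omega))
    · intro h; exact (h (Finset.HasAntidiagonal.mem_antidiagonal.2 rfl)).elim
  ext1 m
  have h1 : PowerSeries.coeff m (derSeries deg D (F * G)) =
      ∑ n ∈ Finset.range (m + 1), ∑ ab ∈ Finset.HasAntidiagonal.antidiagonal n,
        PowerSeries.coeff m (derPoly deg D (PowerSeries.coeff ab.1 F) *
          PowerSeries.monomial ab.2 (PowerSeries.coeff ab.2 G)) +
      sgn k p • ∑ n ∈ Finset.range (m + 1), ∑ ab ∈ Finset.HasAntidiagonal.antidiagonal n,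
        PowerSeries.coeff m (PowerSeries.monomial ab.1 (PowerSeries.coeff ab.1 F) *
          derPoly deg D (PowerSeries.coeff ab.2 G)) := by
    rw [derSeries, PowerSeries.coeff_mk, Finset.smul_sum, ← Finset.sum_add_distrib]
    refine Finset.sum_congr rfl fun n _ => ?_
    rw [PowerSeries.coeff_mul, map_sum, map_sum, Finset.smul_sum, ← Finset.sum_add_distrib]
    refine Finset.sum_congr rfl fun ab _ => ?_
    rw [derPoly_mul deg D (hF ab.1) (hG ab.2), map_add, coeff_smul']
  rw [h1, map_add, coeff_smul', PowerSeries.coeff_mul, PowerSeries.coeff_mul]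
  congr 1
  · rw [sum_fst (FreeAlgebra k I) (fun a b => PowerSeries.coeff m
      (derPoly deg D (PowerSeries.coeff a F) *
        PowerSeries.monomial b (PowerSeries.coeff b G))) m]
    refine Finset.sum_congr rfl fun ib hib => ?_
    rw [derSeries, PowerSeries.coeff_mk, Finset.sum_mul]
    refine Finset.sum_congr rfl fun a _ => ?_
    exact coeff_mul_mon _ _ _ _ _ (Finset.HasAntidiagonal.mem_antidiagonal.1 hib)
  · congr 1
    have swap : ∀ n, ∑ ab ∈ Finset.HasAntidiagonal.antidiagonal n, PowerSeries.coeff m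
        (PowerSeries.monomial ab.1 (PowerSeries.coeff ab.1 F) *
          derPoly deg D (PowerSeries.coeff ab.2 G)) =
        ∑ ba ∈ Finset.HasAntidiagonal.antidiagonal n, PowerSeries.coeff m
        (PowerSeries.monomial ba.2 (PowerSeries.coeff ba.2 F) *
          derPoly deg D (PowerSeries.coeff ba.1 G)) := fun n => by
      rw [← Finset.Nat.sum_antidiagonal_swap]; rfl
    rw [Finset.sum_congr rfl fun n _ => swap n,
      sum_fst (FreeAlgebra k I) (fun b a => PowerSeries.coeff m
        (PowerSeries.monomial a (PowerSeries.coeff a F) *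
          derPoly deg D (PowerSeries.coeff b G))) m, ← Finset.Nat.sum_antidiagonal_swap]
    refine Finset.sum_congr rfl fun aj haj => ?_
    rw [derSeries, PowerSeries.coeff_mk, Finset.mul_sum]
    refine Finset.sum_congr rfl fun b _ => ?_
    exact coeff_mon_mul _ _ _ _ _ (Finset.HasAntidiagonal.mem_antidiagonal.1 haj)

theorem derSeries_add (D : I → PowerSeries (FreeAlgebra k I))
    (F G : PowerSeries (FreeAlgebra k I)) :
    derSeries deg D (F + G) = derSeries deg D F + derSeries deg D G := by
  ext1 m
  simp [derSeries, Finset.sum_add_distrib]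

theorem derSeries_smul (D : I → PowerSeries (FreeAlgebra k I)) (c : k)
    (F : PowerSeries (FreeAlgebra k I)) :
    derSeries deg D (c • F) = c • derSeries deg D F := by
  ext1 m
  simp only [derSeries, PowerSeries.coeff_mk, coeff_smul', map_smul, Finset.smul_sum]

/-- The free complete graded Lie algebra with the derivation of degree `1` that sends the `i`-th
generator to `D i`. -/
noncomputable def freeDerLie (D : ∀ i, (freeLie k deg).V (deg i + 1)) : DerLie k where
  toGradedLie := freeLie k deg
  d {p q} h :=
    { toFun := fun F => ⟨derSeries deg (fun i => (D i).1) F.1,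
        h ▸ derSeries_mem deg (fun i => (D i).2) F.2⟩
      map_add' := fun F G => Subtype.ext (derSeries_add deg _ F.1 G.1)
      map_smul' := fun c F => Subtype.ext (derSeries_smul deg _ c F.1) }
  leibniz {p q r p' q' t} h hr hp h₁ hq h₂ F G := by
    subst h hp hq
    refine Subtype.ext ?_
    change derSeries deg _ (F.1 * G.1 - sgn k (p * q) • (G.1 * F.1)) =
      (derSeries deg _ F.1 * G.1 - sgn k ((p + 1) * q) • (G.1 * derSeries deg _ F.1)) +
      sgn k p • (F.1 * derSeries deg _ G.1 - sgn k (p * (q + 1)) • (derSeries deg _ G.1 * F.1))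
    rw [sub_eq_add_neg, ← neg_smul, derSeries_add, derSeries_smul,
      derSeries_mul deg _ F.2 G.2, derSeries_mul deg _ G.2 F.2]
    simp only [add_mul, mul_add, sgn_add, one_mul, mul_one]
    rcases sgn_eq k (p * q) with h | h <;> rcases sgn_eq k p with h' | h' <;>
      rcases sgn_eq k q with h'' | h'' <;>
      simp only [h, h', h'', one_smul, neg_smul, mul_one, mul_neg, neg_neg] <;> noncomm_ring

/-- The derivation of `freeDerLie deg D` takes the prescribed values on the generators. -/
theorem freeDerLie_d_gen (D : ∀ i, (freeLie k deg).V (deg i + 1)) (i : I) :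
    (freeDerLie deg D).d rfl (lieGen k deg i) = D i := by
  refine Subtype.ext ?_
  change derSeries deg (fun i => (D i).1) (PowerSeries.monomial 1 (FreeAlgebra.ι k i)) = (D i).1
  ext1 m
  rw [derSeries, PowerSeries.coeff_mk]
  rcases Nat.eq_zero_or_pos m with rfl | hm
  · have := (D i).2 0
    rw [liePoly_zero] at this
    rw [this]
    simp [PowerSeries.coeff_monomial]
  · rw [Finset.sum_eq_single 1]
    · rw [PowerSeries.coeff_monomial_same, derPoly_ι]
    · intro n _ hn
      rw [coeff_mon_ne hn]; simp
    · intro h; simp at h; omega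

end Free

/-! ## Contractions of commutative dg algebras and the complete cobar construction -/

/-- Commutative dg algebras (graded-commutative, cohomologically `ℤ`-graded) over `k`. -/
structure CDGA (k : Type u) [Field k] where
  /-- the underlying algebra -/
  A : Type u
  [ring : Ring A]
  [algebra : Algebra k A]
  /-- the homogeneous components -/
  gr : ℤ → Submodule k A
  internal : DirectSum.IsInternal gr
  one_mem : (1 : A) ∈ gr 0
  mul_mem : ∀ {p q : ℤ} {a b : A}, a ∈ gr p → b ∈ gr q → a * b ∈ gr (p + q)
  comm : ∀ {p q : ℤ} {a b : A}, a ∈ gr p → b ∈ gr q → a * b = sgn k (p * q) • (b * a)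
  /-- the differential -/
  d : A →ₗ[k] A
  d_mem : ∀ {p : ℤ} {a : A}, a ∈ gr p → d a ∈ gr (p + 1)
  d_d : ∀ a, d (d a) = 0
  leibniz : ∀ {p : ℤ} {a b : A}, a ∈ gr p → d (a * b) = d a * b + sgn k p • (a * d b)

attribute [instance] CDGA.ring CDGA.algebra

/-- A contraction of the commutative dg algebra `Ω` onto a finite dimensional subcomplex `C` with
homogeneous basis `e i`, `i : I`, of degrees `deg i`. The inclusion of `C` is determined by the
elements `e i` of `Ω`, and the projection `Ω → C` is `a ↦ ∑ i, p i a • e i`. The differential of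
`C` has the matrix `p i (d (e j))`. -/
structure Contraction {k : Type u} [Field k] (Ω : CDGA k) (I : Type) [Fintype I]
    [DecidableEq I] where
  /-- the degrees of the basis of `C` -/
  deg : I → ℤ
  /-- the basis of `C`, as elements of `Ω` -/
  e : I → Ω.A
  /-- the coordinates of the projection onto `C` -/
  p : I → Ω.A →ₗ[k] k
  /-- the homotopy -/
  h : Ω.A →ₗ[k] Ω.A
  e_mem : ∀ i, e i ∈ Ω.gr (deg i)
  p_of_ne : ∀ {q : ℤ} {a : Ω.A} (i : I), a ∈ Ω.gr q → q ≠ deg i → p i a = 0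
  h_mem : ∀ {q : ℤ} {a : Ω.A}, a ∈ Ω.gr q → h a ∈ Ω.gr (q - 1)
  d_e : ∀ j, Ω.d (e j) = ∑ i, p i (Ω.d (e j)) • e i
  p_d : ∀ i a, p i (Ω.d a) = ∑ j, p j a * p i (Ω.d (e j))
  p_e : ∀ i j, p i (e j) = if i = j then 1 else 0
  homotopy : ∀ a, a - ∑ i, p i a • e i = Ω.d (h a) + h (Ω.d a)
  h_e : ∀ i, h (e i) = 0
  p_h : ∀ i a, p i (h a) = 0
  h_h : ∀ a, h (h a) = 0

/-- The binary planar trees with `n` leaves, with leaves labelled by `I`. -/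
def trees (I : Type) [Fintype I] [DecidableEq I] : ℕ → Finset (FreeMagma I)
  | 0 => ∅
  | 1 => Finset.univ.image FreeMagma.of
  | n + 2 => (Finset.HasAntidiagonal.antidiagonal n).attach.biUnion fun ab =>
      have h := Finset.HasAntidiagonal.mem_antidiagonal.1 ab.2
      have : ab.1.1 < n + 1 := by omega
      have : ab.1.2 < n + 1 := by omega
      (trees I (ab.1.1 + 1) ×ˢ trees I (ab.1.2 + 1)).image fun st => st.1 * st.2

theorem mem_trees {I : Type} [Fintype I] [DecidableEq I] {n : ℕ} {t : FreeMagma I} :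
    t ∈ trees I n ↔ t.length = n := by
  induction t generalizing n with
  | ih1 i =>
    have h1 : (FreeMagma.of i).length = 1 := rfl
    rw [h1]
    match n with
    | 0 => simp [trees]
    | 1 => simp [trees]
    | n + 2 =>
      rw [trees]
      simp only [Finset.mem_biUnion, Finset.mem_image]
      constructor
      · rintro ⟨_, _, _, _, h⟩; cases h
      · intro h; omega
  | ih2 s t hs ht =>
    have h1 : (s * t).length = s.length + t.length := rfl
    have ps := s.length_pos
    have pt := t.length_pos
    rw [h1]
    match n with
    | 0 => simp [trees]; omega
    | 1 =>
      rw [trees]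
      constructor
      · intro h
        obtain ⟨i, _, h⟩ := Finset.mem_image.1 h
        cases h
      · intro h; omega
    | n + 2 =>
      rw [trees]
      simp only [Finset.mem_biUnion, Finset.mem_image]
      constructor
      · rintro ⟨⟨ab, hab⟩, -, ⟨s', t'⟩, hst, h⟩
        have hab := Finset.HasAntidiagonal.mem_antidiagonal.1 hab
        cases h
        have h3 := Finset.mem_product.1 hst
        have e1 := hs.1 h3.1
        have e2 := ht.1 h3.2
        change s'.length = ab.1 + 1 at e1
        change t'.length = ab.2 + 1 at e2
        change s'.length + t'.length = n + 2
        omega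
      · intro h
        refine ⟨⟨(s.length - 1, t.length - 1),
          Finset.HasAntidiagonal.mem_antidiagonal.2 (by simp only; omega)⟩, Finset.mem_attach _ _,
          (s, t), Finset.mem_product.2 ⟨hs.2 ?_, ht.2 ?_⟩, rfl⟩
        · simp only; omega
        · simp only; omega

namespace Contraction

variable {k : Type u} [Field k] {Ω : CDGA k} {I : Type} [Fintype I] [DecidableEq I]

/-- The degree `1 - deg i` of the generator `s eᵢ^∨` of `s C^∨`. -/
def genDeg (c : Contraction Ω I) (i : I) : ℤ := 1 - c.deg i

/-- The part of the transferred structure given by a labelled binary tree, before projecting to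
`C`: the basis elements of `C`, included in `Ω`, at the leaves, the product of `Ω` at the
vertices, and the homotopy after every vertex, with a factor `½` for each vertex because planar
trees are counted. The signs are those of the iteration `ψ = κ - ½ h [ψ, ψ]` in the tensor
product of a graded Lie algebra with `Ω`, where `κ = ∑ i, xᵢ ⊗ eᵢ` has degree `1`,
`[x ⊗ a, y ⊗ b] = (-1)^(|a| |y|) [x, y] ⊗ a b` and `h (x ⊗ a) = (-1)^|x| x ⊗ h a`. -/
def treeForm (c : Contraction Ω I) : FreeMagma I → Ω.A
  | .of i => c.e i
  | .mul s t =>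
      -((2 : k)⁻¹ * sgn k ((1 - treeDeg c.genDeg s) * treeDeg c.genDeg t +
        (treeDeg c.genDeg s + treeDeg c.genDeg t))) • c.h (treeForm c s * treeForm c t)

/-- The coefficient of the bracketing `t` in the cobar differential of the generator `s eᵢ^∨`.
A tree with one leaf contributes the dual of the differential of `C`, and a tree with at least
two leaves contributes the dual of the transferred operation (the projection at the root), so
that `dκ + d_C κ + p (½ [ψ, ψ]) = 0` for `ψ = κ - ½ h [ψ, ψ]`. -/
def treeCoeff (c : Contraction Ω I) (i : I) : FreeMagma I → k
  | .of j => -(sgn k (c.genDeg j) * c.p i (Ω.d (c.e j)))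
  | .mul s t =>
      -((2 : k)⁻¹ * sgn k ((1 - treeDeg c.genDeg s) * treeDeg c.genDeg t) *
        c.p i (c.treeForm s * c.treeForm t))

theorem treeForm_mem (c : Contraction Ω I) (t : FreeMagma I) :
    c.treeForm t ∈ Ω.gr (1 - treeDeg c.genDeg t) := by
  induction t with
  | ih1 i =>
    have : 1 - treeDeg c.genDeg (.of i) = c.deg i := by simp [genDeg]
    rw [this]; exact c.e_mem i
  | ih2 s t hs ht =>
    have : 1 - treeDeg c.genDeg (s * t) =
      (1 - treeDeg c.genDeg s) + (1 - treeDeg c.genDeg t) - 1 := by simp; ring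
    rw [this]
    exact Submodule.smul_mem _ _ (c.h_mem (Ω.mul_mem hs ht))

theorem treeCoeff_eq_zero (c : Contraction Ω I) (i : I) (t : FreeMagma I)
    (ht : treeDeg c.genDeg t ≠ c.genDeg i + 1) : c.treeCoeff i t = 0 := by
  induction t with
  | ih1 j =>
    have : c.p i (Ω.d (c.e j)) = 0 := by
      refine c.p_of_ne i (Ω.d_mem (c.e_mem j)) fun h => ht ?_
      simp only [treeDeg_of, genDeg]; omega
    change -(_ * c.p i (Ω.d (c.e j))) = 0
    rw [this, mul_zero, neg_zero]
  | ih2 s t _ _ =>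
    have : c.p i (c.treeForm s * c.treeForm t) = 0 := by
      refine c.p_of_ne i (Ω.mul_mem (c.treeForm_mem s) (c.treeForm_mem t)) fun h => ht ?_
      simp only [treeDeg_mul]
      simp only [genDeg] at h ⊢
      omega
    change -(_ * c.p i (c.treeForm s * c.treeForm t)) = 0
    rw [this, mul_zero, neg_zero]

/-- The cobar differential of the generator `s eᵢ^∨`: the sum over all labelled binary trees. -/
noncomputable def genD (c : Contraction Ω I) (i : I) :
    (freeLie k c.genDeg).V (c.genDeg i + 1) :=
  ⟨PowerSeries.mk fun n => ∑ t ∈ trees I n, c.treeCoeff i t • treeLie k c.genDeg t, fun n => by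
    rw [PowerSeries.coeff_mk]
    refine Submodule.sum_mem _ fun t ht => ?_
    by_cases h : treeDeg c.genDeg t = c.genDeg i + 1
    · exact Submodule.smul_mem _ _ (Submodule.subset_span ⟨t, mem_trees.1 ht, h, rfl⟩)
    · rw [c.treeCoeff_eq_zero i t h, zero_smul]; exact zero_mem _⟩

/-- The complete cobar construction of `s C^∨`, where `C` carries the homotopy commutative
algebra structure transferred from `Ω` along the contraction. -/
noncomputable def cobar (c : Contraction Ω I) : DerLie k := freeDerLie c.genDeg c.genD

/-- The generator `s eᵢ^∨`. -/
noncomputable def gen (c : Contraction Ω I) (i : I) : c.cobar.V (c.genDeg i) :=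
  lieGen k c.genDeg i

end Contraction

/-! ## Polynomial forms on the point and on the interval -/

section Forms

open Polynomial

variable (k : Type u) [Field k]

/-- The grading of `Ω₀ = k`, concentrated in degree `0`. -/
def gr0 (n : ℤ) : Submodule k k where
  carrier := {a | n ≠ 0 → a = 0}
  zero_mem' := fun _ => rfl
  add_mem' := fun ha hb hn => by rw [ha hn, hb hn, add_zero]
  smul_mem' := fun c a ha hn => by rw [ha hn, smul_zero]

theorem gr0_internal : DirectSum.IsInternal (gr0 k) := by
  classical
  refine @DirectSum.Decomposition.isInternal _ _ _ _ _ _ _ (gr0 k)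
    (DirectSum.Decomposition.ofLinearMap (gr0 k)
      ((DirectSum.lof k ℤ (fun n => gr0 k n) 0) ∘ₗ
        (LinearMap.id.codRestrict (gr0 k 0) fun a h => absurd rfl h)) ?_ ?_)
  · ext
    simp only [LinearMap.comp_apply, DirectSum.coeLinearMap_lof]
    rfl
  · ext n ⟨a, ha⟩ : 2
    by_cases hn : n = 0
    · subst hn
      simp only [LinearMap.comp_apply, DirectSum.coeLinearMap_lof, LinearMap.id_apply]
      rfl
    · obtain rfl : a = 0 := ha hn
      have : (⟨0, ha⟩ : gr0 k n) = 0 := rfl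
      rw [this, map_zero, map_zero]

/-- The polynomial forms `Ω₀ = k` on the point. -/
def omega0 : CDGA k where
  A := k
  gr := gr0 k
  internal := gr0_internal k
  one_mem h := absurd rfl h
  mul_mem := by
    intro p q a b ha hb h
    by_cases hp : p = 0
    · rw [hb (by omega), mul_zero]
    · rw [ha hp, zero_mul]
  comm := by
    intro p q a b ha hb
    by_cases hp : p = 0
    · subst hp; simp [mul_comm]
    · rw [ha hp]; simp
  d := 0
  d_mem _ := zero_mem _
  d_d _ := rfl
  leibniz _ := by simp

/-- The contraction of `Ω₀ = k` onto `C₀ = k`: inclusion and projection are the identity and the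
homotopy is zero. -/
def dupont0 : Contraction (omega0 k) Unit where
  deg _ := 0
  e _ := (1 : k)
  p _ := LinearMap.id (M := k)
  h := 0
  e_mem _ := (omega0 k).one_mem
  p_of_ne _ ha hq := ha hq
  h_mem _ := zero_mem _
  d_e _ := by
    change (0 : k) = ∑ _ : Unit, (0 : k) * 1
    simp
  p_d _ a := by
    change k at a
    change (0 : k) = ∑ _ : Unit, a * (0 : k)
    simp
  p_e _ _ := by
    change (1 : k) = _
    simp
  homotopy a := by
    change k at a
    change a - ∑ _ : Unit, a * 1 = (0 : k) + 0
    simp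
  h_e _ := rfl
  p_h _ _ := rfl
  h_h _ := rfl

/-- The dg Lie algebra `mc₀`. -/
noncomputable def mc0 : DerLie k := (dupont0 k).cobar

/-- The generator `α = s 1^∨` of `mc₀`, of degree `1`. -/
noncomputable def mc0Gen : (mc0 k).V 1 := (dupont0 k).gen ()

/-- The grading of `k[t] ⊕ k[t] dt`. -/
def gr1 (n : ℤ) : Submodule k (DualNumber k[X]) where
  carrier := {a | (n ≠ 0 → a.fst = 0) ∧ (n ≠ 1 → a.snd = 0)}
  zero_mem' := ⟨fun _ => rfl, fun _ => rfl⟩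
  add_mem' := fun ha hb => ⟨fun hn => by simp [ha.1 hn, hb.1 hn],
    fun hn => by simp [ha.2 hn, hb.2 hn]⟩
  smul_mem' := fun c a ha => ⟨fun hn => by simp [ha.1 hn], fun hn => by simp [ha.2 hn]⟩

/-- The coefficient `f` of the form `f + g dt`. -/
def fstL : DualNumber k[X] →ₗ[k] k[X] where
  toFun := TrivSqZeroExt.fst
  map_add' _ _ := rfl
  map_smul' _ _ := rfl

/-- The coefficient `g` of the form `f + g dt`. -/
def sndL : DualNumber k[X] →ₗ[k] k[X] where
  toFun := TrivSqZeroExt.snd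
  map_add' _ _ := rfl
  map_smul' _ _ := rfl

/-- The polynomial `f` as a `0`-form. -/
noncomputable def inlL : k[X] →ₗ[k] DualNumber k[X] where
  toFun := TrivSqZeroExt.inl
  map_add' _ _ := TrivSqZeroExt.inl_add _ _ _
  map_smul' _ _ := TrivSqZeroExt.inl_smul _ _ _

/-- The `1`-form `g dt`. -/
noncomputable def inrL : k[X] →ₗ[k] DualNumber k[X] where
  toFun := TrivSqZeroExt.inr
  map_add' _ _ := TrivSqZeroExt.inr_add _ _ _
  map_smul' _ _ := TrivSqZeroExt.inr_smul _ _ _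

@[simp] theorem fst_inlL (f : k[X]) : (inlL k f).fst = f := rfl
@[simp] theorem snd_inlL (f : k[X]) : (inlL k f).snd = 0 := rfl
@[simp] theorem fst_inrL (f : k[X]) : (inrL k f).fst = 0 := rfl
@[simp] theorem snd_inrL (f : k[X]) : (inrL k f).snd = f := rfl
@[simp] theorem fstL_apply (a : DualNumber k[X]) : fstL k a = a.fst := rfl
@[simp] theorem sndL_apply (a : DualNumber k[X]) : sndL k a = a.snd := rfl

theorem inlL_mem (f : k[X]) : inlL k f ∈ gr1 k 0 := ⟨fun h => absurd rfl h, fun _ => rfl⟩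

theorem inrL_mem (f : k[X]) : inrL k f ∈ gr1 k 1 := ⟨fun _ => rfl, fun h => absurd rfl h⟩

theorem gr1_internal : DirectSum.IsInternal (gr1 k) := by
  classical
  refine @DirectSum.Decomposition.isInternal _ _ _ _ _ _ _ (gr1 k)
    (DirectSum.Decomposition.ofLinearMap (gr1 k)
      ((DirectSum.lof k ℤ (fun n => gr1 k n) 0) ∘ₗ
        ((inlL k ∘ₗ fstL k).codRestrict (gr1 k 0) fun a => inlL_mem k _) +
       (DirectSum.lof k ℤ (fun n => gr1 k n) 1) ∘ₗ
        ((inrL k ∘ₗ sndL k).codRestrict (gr1 k 1) fun a => inrL_mem k _)) ?_ ?_)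
  · refine LinearMap.ext fun a => ?_
    simp only [LinearMap.comp_apply, LinearMap.add_apply, map_add, DirectSum.coeLinearMap_lof]
    change inlL k a.fst + inrL k a.snd = a
    ext <;> simp
  · ext n ⟨a, ha⟩ : 2
    simp only [LinearMap.comp_apply, LinearMap.add_apply, DirectSum.coeLinearMap_lof,
      LinearMap.id_apply]
    by_cases h0 : n = 0
    · subst h0
      have e1 : (inlL k ∘ₗ fstL k).codRestrict (gr1 k 0) (fun a => inlL_mem k _) a = ⟨a, ha⟩ :=
        Subtype.ext (TrivSqZeroExt.ext rfl (ha.2 (by norm_num)).symm)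
      have e2 : (inrL k ∘ₗ sndL k).codRestrict (gr1 k 1) (fun a => inrL_mem k _) a = 0 :=
        Subtype.ext (TrivSqZeroExt.ext rfl (ha.2 (by norm_num)))
      rw [e1, e2, map_zero, add_zero]
    · have e1 : (inlL k ∘ₗ fstL k).codRestrict (gr1 k 0) (fun a => inlL_mem k _) a = 0 :=
        Subtype.ext (TrivSqZeroExt.ext (ha.1 h0) rfl)
      by_cases h1 : n = 1
      · subst h1
        have e2 : (inrL k ∘ₗ sndL k).codRestrict (gr1 k 1) (fun a => inrL_mem k _) a = ⟨a, ha⟩ :=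
          Subtype.ext (TrivSqZeroExt.ext (ha.1 h0).symm rfl)
        rw [e1, e2, map_zero, zero_add]
      · have e2 : (inrL k ∘ₗ sndL k).codRestrict (gr1 k 1) (fun a => inrL_mem k _) a = 0 :=
          Subtype.ext (TrivSqZeroExt.ext rfl (ha.2 h1))
        have e3 : (⟨a, ha⟩ : gr1 k n) = 0 := Subtype.ext (TrivSqZeroExt.ext (ha.1 h0) (ha.2 h1))
        rw [e1, e2, e3]
        simp only [map_zero, add_zero]

/-- The polynomial forms on the interval: with `t = t₁`, `t₀ = 1 - t` and `dt = dt₁ = -dt₀`, the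
algebra `Ω₁ = k[t₀, t₁, dt₀, dt₁] / (t₀ + t₁ - 1, dt₀ + dt₁)` is `k[t] ⊕ k[t] dt` with
`dt * dt = 0`. The form `f + g dt` is the dual number with components `f` and `g`. -/
noncomputable def omega1 : CDGA k where
  A := DualNumber k[X]
  gr := gr1 k
  internal := gr1_internal k
  one_mem := ⟨fun h => absurd rfl h, fun _ => rfl⟩
  mul_mem := by
    intro p q a b ha hb
    refine ⟨fun h => ?_, fun h => ?_⟩
    · rw [TrivSqZeroExt.fst_mul]
      by_cases hp : p = 0
      · rw [hb.1 (by omega), mul_zero]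
      · rw [ha.1 hp, zero_mul]
    · rw [DualNumber.snd_mul]
      have h1 : a.fst * b.snd = 0 := by
        by_cases hp : p = 0
        · rw [hb.2 (by omega), mul_zero]
        · rw [ha.1 hp, zero_mul]
      have h2 : a.snd * b.fst = 0 := by
        by_cases hp : p = 1
        · rw [hb.1 (by omega), mul_zero]
        · rw [ha.2 hp, zero_mul]
      rw [h1, h2, add_zero]
  comm := by
    intro p q a b ha hb
    by_cases hp : p = 0
    · subst hp; simp [mul_comm]
    by_cases hq : q = 0
    · subst hq; simp [mul_comm]
    have h1 : a * b = 0 := by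
      ext <;> simp [ha.1 hp, hb.1 hq]
    rw [mul_comm b, h1, smul_zero]
  d := inrL k ∘ₗ derivative ∘ₗ fstL k
  d_mem := by
    intro p a ha
    refine ⟨fun _ => rfl, fun h => ?_⟩
    change derivative a.fst = 0
    rw [ha.1 (by omega), derivative_zero]
  d_d a := by simp
  leibniz := by
    intro p a b ha
    by_cases hp : p = 0
    · subst hp
      ext <;> simp [mul_comm, add_comm]
    · ext <;> simp [ha.1 hp]

/-- The formal integral `∫₀ᵗ g dt` of a polynomial. -/
noncomputable def antideriv : k[X] →ₗ[k] k[X] :=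
  Polynomial.lsum fun n => ((n + 1 : ℕ) : k)⁻¹ • Polynomial.monomial (n + 1)

theorem antideriv_monomial (n : ℕ) (c : k) :
    antideriv k (monomial n c) = monomial (n + 1) (((n + 1 : ℕ) : k)⁻¹ * c) := by
  rw [antideriv, Polynomial.lsum_apply, Polynomial.sum_monomial_index]
  · rw [LinearMap.smul_apply, Polynomial.smul_monomial, smul_eq_mul]
  · simp

theorem derivative_antideriv [CharZero k] (g : k[X]) : derivative (antideriv k g) = g := by
  induction g using Polynomial.induction_on' with
  | add p q hp hq => rw [map_add, map_add, hp, hq]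
  | monomial n c =>
    rw [antideriv_monomial, derivative_monomial]
    have : ((n + 1 : ℕ) : k) ≠ 0 := by exact_mod_cast Nat.succ_ne_zero n
    congr 1
    field_simp

theorem antideriv_derivative [CharZero k] (f : k[X]) :
    antideriv k (derivative f) = f - C (f.eval 0) := by
  induction f using Polynomial.induction_on' with
  | add p q hp hq => rw [map_add, map_add, hp, hq, eval_add, C_add]; ring
  | monomial n c =>
    rw [derivative_monomial, antideriv_monomial]
    rcases n with _ | n
    · simp
    · have : ((n + 1 : ℕ) : k) ≠ 0 := by exact_mod_cast Nat.succ_ne_zero n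
      rw [Nat.add_sub_cancel]
      have h2 : ((n + 1 : ℕ) : k)⁻¹ * (c * ((n + 1 : ℕ) : k)) = c := by field_simp
      rw [h2]; simp

theorem antideriv_eval_zero (g : k[X]) : (antideriv k g).eval 0 = 0 := by
  induction g using Polynomial.induction_on' with
  | add p q hp hq => rw [map_add, eval_add, hp, hq, add_zero]
  | monomial n c => rw [antideriv_monomial]; simp

/-- The nonempty faces of the interval: the two vertices and the edge. -/
inductive Face1
  | v0 | v1 | e01
  deriving DecidableEq

instance : Fintype Face1 := ⟨{.v0, .v1, .e01}, by rintro ⟨⟩ <;> simp⟩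

theorem Face1.sum_eq {M : Type u} [AddCommMonoid M] (f : Face1 → M) :
    ∑ i, f i = f .v0 + f .v1 + f .e01 := by
  change ∑ i ∈ {Face1.v0, Face1.v1, Face1.e01}, f i = _
  rw [Finset.sum_insert (by simp), Finset.sum_insert (by simp), Finset.sum_singleton, add_assoc]

/-- The dimension of a face. -/
def Face1.dim : Face1 → ℤ
  | .v0 => 0
  | .v1 => 0
  | .e01 => 1

/-- The basic forms `ω₀ = t₀ = 1 - t`, `ω₁ = t₁ = t` and `ω₀₁ = t₀ dt₁ - t₁ dt₀ = dt`. -/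
noncomputable def basicForm : Face1 → DualNumber k[X]
  | .v0 => inlL k (1 - X)
  | .v1 => inlL k X
  | .e01 => inrL k 1

/-- Integration of a form over the faces: the values at the vertices `t = 0` and `t = 1`, and
`∫₀¹ g dt`. -/
noncomputable def faceIntegral : Face1 → DualNumber k[X] →ₗ[k] k
  | .v0 => leval 0 ∘ₗ fstL k
  | .v1 => leval 1 ∘ₗ fstL k
  | .e01 => leval 1 ∘ₗ antideriv k ∘ₗ sndL k

/-- Dupont's homotopy on the interval: `f + g dt ↦ ∫₀ᵗ g - t ∫₀¹ g`. -/
noncomputable def dupontHomotopy : DualNumber k[X] →ₗ[k] DualNumber k[X] :=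
  inlL k ∘ₗ (antideriv k ∘ₗ sndL k -
    (LinearMap.toSpanSingleton k k[X] X) ∘ₗ faceIntegral k .e01)

theorem antideriv_one [CharZero k] : antideriv k 1 = X := by
  simpa using antideriv_derivative k X

theorem faceIntegral_v0 (a : DualNumber k[X]) : faceIntegral k .v0 a = eval 0 a.fst := rfl
theorem faceIntegral_v1 (a : DualNumber k[X]) : faceIntegral k .v1 a = eval 1 a.fst := rfl
theorem faceIntegral_e01 (a : DualNumber k[X]) :
    faceIntegral k .e01 a = eval 1 (antideriv k a.snd) := rfl
theorem dupontHomotopy_apply (a : DualNumber k[X]) : dupontHomotopy k a =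
    inlL k (antideriv k a.snd - eval 1 (antideriv k a.snd) • X) := rfl

theorem basicForm_d [CharZero k] (j : Face1) : inrL k (derivative (basicForm k j).fst) =
    ∑ i, faceIntegral k i (inrL k (derivative (basicForm k j).fst)) • basicForm k i := by
  rw [Face1.sum_eq]
  simp only [faceIntegral_v0, faceIntegral_v1, faceIntegral_e01, snd_inrL, fst_inrL,
    antideriv_derivative]
  apply TrivSqZeroExt.ext <;> cases j <;> simp [basicForm]

theorem faceIntegral_d [CharZero k] (i : Face1) (a : DualNumber k[X]) :
    faceIntegral k i (inrL k (derivative a.fst)) =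
      ∑ j, faceIntegral k j a * faceIntegral k i (inrL k (derivative (basicForm k j).fst)) := by
  rw [Face1.sum_eq]
  cases i <;> simp only [faceIntegral_v0, faceIntegral_v1, faceIntegral_e01, snd_inrL, fst_inrL,
    antideriv_derivative] <;> simp [basicForm]
  ring

theorem faceIntegral_basicForm [CharZero k] (i j : Face1) :
    faceIntegral k i (basicForm k j) = if i = j then 1 else 0 := by
  cases i <;> cases j <;> simp [faceIntegral_v0, faceIntegral_v1, faceIntegral_e01, basicForm,
    antideriv_one]

theorem dupont_homotopy [CharZero k] (a : DualNumber k[X]) :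
    a - ∑ i, faceIntegral k i a • basicForm k i =
      inrL k (derivative (dupontHomotopy k a).fst) +
        dupontHomotopy k (inrL k (derivative a.fst)) := by
  rw [Face1.sum_eq]
  simp only [faceIntegral_v0, faceIntegral_v1, faceIntegral_e01, dupontHomotopy_apply, snd_inrL,
    fst_inlL, antideriv_derivative, basicForm]
  apply TrivSqZeroExt.ext
  · simp only [TrivSqZeroExt.fst_sub, TrivSqZeroExt.fst_add, TrivSqZeroExt.fst_smul, fst_inlL,
      fst_inrL, eval_sub, eval_C, smul_eq_C_mul, C_sub]
    ring
  · simp only [TrivSqZeroExt.snd_sub, TrivSqZeroExt.snd_add, TrivSqZeroExt.snd_smul, snd_inlL,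
      snd_inrL, derivative_sub, derivative_antideriv, derivative_smul, derivative_X]
    simp

theorem dupontHomotopy_basicForm [CharZero k] (i : Face1) :
    dupontHomotopy k (basicForm k i) = 0 := by
  cases i <;> simp [dupontHomotopy_apply, basicForm, antideriv_one]

theorem faceIntegral_dupontHomotopy (i : Face1) (a : DualNumber k[X]) :
    faceIntegral k i (dupontHomotopy k a) = 0 := by
  cases i <;> simp [dupontHomotopy_apply, faceIntegral_v0, faceIntegral_v1, faceIntegral_e01,
    antideriv_eval_zero]

theorem dupontHomotopy_sq (a : DualNumber k[X]) :
    dupontHomotopy k (dupontHomotopy k a) = 0 := by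
  simp [dupontHomotopy_apply]

/-- Dupont's contraction of `Ω₁` onto the span `C₁` of the basic forms. (Its homotopy is the only
one that satisfies the identities of a contraction for these projections.) -/
noncomputable def dupont1 [CharZero k] : Contraction (omega1 k) Face1 where
  deg := Face1.dim
  e := basicForm k
  p := faceIntegral k
  h := dupontHomotopy k
  e_mem := by
    rintro ⟨⟩
    · exact inlL_mem k _
    · exact inlL_mem k _
    · exact inrL_mem k _
  p_of_ne := by
    rintro q a ⟨⟩ ha hq
    · change eval 0 a.fst = 0
      rw [ha.1 hq, eval_zero]
    · change eval 1 a.fst = 0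
      rw [ha.1 hq, eval_zero]
    · change eval 1 (antideriv k a.snd) = 0
      rw [ha.2 hq, map_zero, eval_zero]
  h_mem := by
    intro q a ha
    refine ⟨fun h => ?_, fun _ => rfl⟩
    change antideriv k a.snd - (eval 1 (antideriv k a.snd)) • X = 0
    rw [ha.2 (by omega), map_zero, eval_zero, zero_smul, sub_zero]
  d_e := basicForm_d k
  p_d := faceIntegral_d k
  p_e := faceIntegral_basicForm k
  homotopy := dupont_homotopy k
  h_e := dupontHomotopy_basicForm k
  p_h := faceIntegral_dupontHomotopy k
  h_h := dupontHomotopy_sq k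

/-- The dg Lie algebra `mc₁`. -/
noncomputable def mc1 [CharZero k] : DerLie k := (dupont1 k).cobar

/-- The generator `α₀ = s ω₀^∨` of `mc₁`, of degree `1`. -/
noncomputable def mc1Gen0 [CharZero k] : (mc1 k).V 1 := (dupont1 k).gen .v0

/-- The generator `α₁ = s ω₁^∨` of `mc₁`, of degree `1`. -/
noncomputable def mc1Gen1 [CharZero k] : (mc1 k).V 1 := (dupont1 k).gen .v1

/-- The generator `λ = s ω₀₁^∨` of `mc₁`, of degree `0`. -/
noncomputable def mc1Gen01 [CharZero k] : (mc1 k).V 0 := (dupont1 k).gen .e01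

end Forms

end LieMC

/-!
Over a field of characteristic `0` the Dynkin–Specht–Wever theorem evaluates Lie polynomials in any
graded Lie algebra: a Lie polynomial of word length `n` is `1 / n` times its own right-normed
bracketing. Completeness of the target extends this to Lie series, which gives the universal
property of `mc₀` and `mc₁` as graded Lie algebras.

The evaluations at the two vertices are augmentations of the transferred structure: they send the
sum `ψ` over trees to a single generator, so that the generators dual to the vertices are
Maurer–Cartan elements. In the transferred structure on the interval, the `0`-form part of `ψ` is
the flow `α(t)` of the gauge equation for `λ`, because the `1`-form part of `ψ` is just `λ ⊗ ω₀₁`: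
only the trees with a leaf `ω₀₁` at the root contribute. Dupont's homotopy vanishes at the vertices,
so the flow runs from `α₀` to `α₁`.

The curvature of the flow satisfies the same linear flow equation with `d²λ` in place of `dλ`; it
vanishes at both ends, which forces `d²λ = 0`. Similarly `dλ` is determined by the two ends of the
flow, so that the isomorphism of graded Lie algebras given by freeness respects the differentials.
-/

namespace LieMC

namespace GradedLie

open Filter Finset

variable {k : Type u} [Field k] {L M : GradedLie k}

theorem F_anti {m n : ℕ} (h : m ≤ n) (p : ℤ) : L.F n p ≤ L.F m p :=
  Submodule.span_mono fun _ ⟨l, hl, hx⟩ => ⟨l, h.trans hl, hx⟩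

theorem IsBracketing.mem_F {n : ℕ} {p : ℤ} {x : L.V p} (hx : L.IsBracketing n x) : x ∈ L.F n p :=
  Submodule.subset_span ⟨n, le_rfl, hx⟩

theorem mem_F_one {p : ℤ} (x : L.V p) : x ∈ L.F 1 p :=
  (IsBracketing.elem x).mem_F

theorem bracket_mem_F {m n : ℕ} {p q r : ℤ} (h : p + q = r) {x : L.V p} {y : L.V q}
    (hx : x ∈ L.F m p) (hy : y ∈ L.F n q) : L.bracket h x y ∈ L.F (m + n) r := by
  have hxy := Submodule.apply_mem_map₂ (L.bracket h) hx hy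
  rw [F, F, Submodule.map₂_span_span] at hxy
  refine Submodule.span_mono ?_ hxy
  rintro _ ⟨x, ⟨i, hi, hx⟩, y, ⟨j, hj, hy⟩, rfl⟩
  exact ⟨i + j, by omega, .bracket h hx hy⟩

theorem bracket_mem_F_left {m : ℕ} {p q r : ℤ} (h : p + q = r) {x : L.V p} (y : L.V q)
    (hx : x ∈ L.F m p) : L.bracket h x y ∈ L.F m r :=
  F_anti (by omega) _ (bracket_mem_F h hx (mem_F_one y))

theorem bracket_mem_F_right {m : ℕ} {p q r : ℤ} (h : p + q = r) (x : L.V p) {y : L.V q}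
    (hy : y ∈ L.F m q) : L.bracket h x y ∈ L.F m r :=
  F_anti (by omega) _ (bracket_mem_F h (mem_F_one x) hy)

theorem IsBracketing.map (φ : Hom L M) {n : ℕ} {p : ℤ} {x : L.V p} (hx : L.IsBracketing n x) :
    M.IsBracketing n (φ.f p x) := by
  induction hx with
  | elem x => exact .elem _
  | bracket h _ _ hx hy => rw [φ.map_bracket]; exact .bracket h hx hy

theorem Hom.map_mem_F (φ : Hom L M) {n : ℕ} {p : ℤ} {x : L.V p} (hx : x ∈ L.F n p) :
    φ.f p x ∈ M.F n p := by
  suffices L.F n p ≤ (M.F n p).comap (φ.f p) from this hx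
  refine Submodule.span_le.2 ?_
  rintro x ⟨m, hm, hx⟩
  exact F_anti hm p (hx.map φ).mem_F

/-- The series `∑ₙ cₙ` converges to `b` for the canonical filtration. -/
def SumsTo (L : GradedLie k) {p : ℤ} (c : ℕ → L.V p) (b : L.V p) : Prop :=
  ∀ N, ∀ᶠ n in atTop, ∑ m ∈ range n, c m - b ∈ L.F N p

namespace SumsTo

variable {p q : ℤ} {c e : ℕ → L.V p} {a b : L.V p}

theorem add (hc : L.SumsTo c a) (he : L.SumsTo e b) :
    L.SumsTo (fun n => c n + e n) (a + b) := fun N => by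
  filter_upwards [hc N, he N] with n hcn hen
  rw [sum_add_distrib, add_sub_add_comm]
  exact add_mem hcn hen

theorem sub (hc : L.SumsTo c a) (he : L.SumsTo e b) :
    L.SumsTo (fun n => c n - e n) (a - b) := fun N => by
  filter_upwards [hc N, he N] with n hcn hen
  rw [sum_sub_distrib, sub_sub_sub_comm]
  exact sub_mem hcn hen

theorem map {f : L.V p →ₗ[k] M.V q} (hf : ∀ {N x}, x ∈ L.F N p → f x ∈ M.F N q)
    (hc : L.SumsTo c a) : M.SumsTo (fun n => f (c n)) (f a) := fun N => by
  filter_upwards [hc N] with n hcn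
  rw [← map_sum, ← map_sub]
  exact hf hcn

theorem smul (t : k) (hc : L.SumsTo c a) : L.SumsTo (fun n => t • c n) (t • a) := fun N => by
  filter_upwards [hc N] with n hcn
  rw [← smul_sum, ← smul_sub]
  exact Submodule.smul_mem _ t hcn

theorem single {m : ℕ} (hc : ∀ n, n ≠ m → c n = 0) : L.SumsTo c (c m) := fun N => by
  filter_upwards [eventually_gt_atTop m] with n hn
  rw [sum_eq_single_of_mem m (mem_range.2 hn) fun n _ => hc n, sub_self]
  exact zero_mem _

theorem eventually_mem_F (hc : L.SumsTo c a) (N : ℕ) : ∀ᶠ n in atTop, c n ∈ L.F N p := by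
  filter_upwards [hc N, (tendsto_add_atTop_nat 1).eventually (hc N)] with n hn hn'
  have := sub_mem hn' hn
  rwa [sum_range_succ, sub_sub_sub_cancel_right, add_sub_cancel_left] at this

theorem unique (hL : L.IsComplete) (ha : L.SumsTo c a) (hb : L.SumsTo c b) : a = b := by
  refine sub_eq_zero.1 ((hL p).1 _ fun N => ?_)
  obtain ⟨n, hna, hnb⟩ := ((ha N).and (hb N)).exists
  simpa using sub_mem hnb hna

end SumsTo

theorem IsComplete.exists_sumsTo (hL : L.IsComplete) {p : ℤ} {c : ℕ → L.V p}
    (hc : ∀ n, c n ∈ L.F n p) : ∃ b, L.SumsTo c b := by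
  obtain ⟨b, hb⟩ := (hL p).2 (fun n => ∑ m ∈ range n, c m) fun n => by
    rw [sum_range_succ, add_sub_cancel_left]
    exact hc n
  refine ⟨b, fun N => ?_⟩
  filter_upwards [eventually_ge_atTop N] with n hn
  exact F_anti hn p (sub_mem_comm_iff.1 (hb n))

/-- The coefficients of the bracket of the power series with coefficients `c` and `e`. -/
def cauchyBracket (L : GradedLie k) {p q r : ℤ} (h : p + q = r) (c : ℕ → L.V p) (e : ℕ → L.V q)
    (n : ℕ) : L.V r :=
  ∑ ij ∈ antidiagonal n, L.bracket h (c ij.1) (e ij.2)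

end GradedLie

theorem sum_square_sub_sum_antidiagonal_mem {M : Type*} [AddCommGroup M] {S : Type*}
    [SetLike S M] [AddSubgroupClass S M] (s : S) (f : ℕ → ℕ → M) (n : ℕ)
    (hf : ∀ i j, n ≤ i + j → f i j ∈ s) :
    ∑ i ∈ Finset.range n, ∑ j ∈ Finset.range n, f i j -
      ∑ m ∈ Finset.range n, ∑ ij ∈ Finset.HasAntidiagonal.antidiagonal m, f ij.1 ij.2 ∈ s := by
  have triangle : ∑ m ∈ Finset.range n, ∑ ij ∈ Finset.HasAntidiagonal.antidiagonal m, f ij.1 ij.2 =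
      ∑ ij ∈ Finset.range n ×ˢ Finset.range n with ij.1 + ij.2 < n, f ij.1 ij.2 := by
    rw [← Finset.sum_fiberwise_of_maps_to (t := Finset.range n) (g := fun ij : ℕ × ℕ => ij.1 + ij.2)
      fun ij hij => Finset.mem_range.2 (Finset.mem_filter.1 hij).2]
    refine Finset.sum_congr rfl fun m hm => Finset.sum_congr ?_ fun _ _ => rfl
    ext ⟨i, j⟩
    simp only [Finset.mem_range, Finset.HasAntidiagonal.mem_antidiagonal, Finset.mem_filter,
      Finset.mem_product] at hm ⊢
    omega
  rw [triangle, ← Finset.sum_product', ← Finset.sum_filter_add_sum_filter_not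
    (Finset.range n ×ˢ Finset.range n) (fun ij => ij.1 + ij.2 < n), add_sub_cancel_left]
  exact sum_mem fun ij hij => hf _ _ (not_lt.1 (Finset.mem_filter.1 hij).2)

namespace GradedLie

open Filter Finset

variable {k : Type u} [Field k] {L M : GradedLie k}

theorem SumsTo.cauchyBracket {p q r : ℤ} (h : p + q = r) {c : ℕ → L.V p} {e : ℕ → L.V q}
    {a : L.V p} {b : L.V q} (hc : L.SumsTo c a) (he : L.SumsTo e b) :
    L.SumsTo (L.cauchyBracket h c e) (L.bracket h a b) := fun N => by
  obtain ⟨K, hK⟩ := eventually_atTop.1 ((hc.eventually_mem_F N).and (he.eventually_mem_F N))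
  filter_upwards [hc N, he N, eventually_ge_atTop (2 * K)] with n hcn hen hn
  have off_triangle := sum_square_sub_sum_antidiagonal_mem (L.F N r)
    (fun i j => L.bracket h (c i) (e j)) n fun i j hij => by
      rcases le_or_gt K i with hi | hi
      · exact bracket_mem_F_left h _ (hK i hi).1
      · exact bracket_mem_F_right h _ (hK j (by omega)).2
  have square : ∑ i ∈ range n, ∑ j ∈ range n, L.bracket h (c i) (e j) =
      L.bracket h (∑ i ∈ range n, c i) (∑ j ∈ range n, e j) := by
    simp only [map_sum, LinearMap.sum_apply]
    exact sum_comm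
  rw [square] at off_triangle
  convert sub_mem (add_mem (bracket_mem_F_left h (∑ j ∈ range n, e j) hcn)
    (bracket_mem_F_right h a hen)) off_triangle using 1
  simp only [GradedLie.cauchyBracket, map_sub, LinearMap.sub_apply]
  abel

section Flow

variable {p : ℤ} {x : L.V 0} {u v : L.V p} {c e : ℕ → L.V p}

/-- The power series `c(t) = ∑ₙ cₙ tⁿ` solves the flow equation `c'(t) = u - [x, c(t)]`. -/
def IsFlow (L : GradedLie k) {p : ℤ} (x : L.V 0) (u : L.V p) (c : ℕ → L.V p) : Prop :=
  ∀ n : ℕ, ((n + 1 : ℕ) : k) • c (n + 1) =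
    (if n = 0 then u else 0) - L.bracket (zero_add p) x (c n)

theorem IsFlow.sub (hc : L.IsFlow x u c) (he : L.IsFlow x v e) :
    L.IsFlow x (u - v) (fun n => c n - e n) := fun n => by
  rw [smul_sub, hc, he, map_sub]
  split_ifs <;> abel

theorem IsFlow.map (hc : L.IsFlow x u c) (φ : Hom L M) :
    M.IsFlow (φ.f 0 x) (φ.f p u) (fun n => φ.f p (c n)) := fun n => by
  rw [← map_smul, hc, map_sub, φ.map_bracket, apply_ite (φ.f p), map_zero]

variable [CharZero k]

theorem IsFlow.mem_F (hc : L.IsFlow x u c) (h0 : c 0 = 0) {N : ℕ} (hu : u ∈ L.F N p) (n : ℕ) :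
    c (n + 1) ∈ L.F (N + n) p := by
  have hn : ((n + 1 : ℕ) : k) ≠ 0 := Nat.cast_ne_zero.2 n.succ_ne_zero
  rw [← Submodule.smul_mem_iff _ hn, hc]
  induction n with
  | zero => simpa [h0] using hu
  | succ n ih =>
    have hn : ((n + 1 : ℕ) : k) ≠ 0 := Nat.cast_ne_zero.2 n.succ_ne_zero
    rw [if_neg n.succ_ne_zero, zero_sub, neg_mem_iff, ← add_assoc, add_comm]
    exact bracket_mem_F _ (mem_F_one x)
      ((Submodule.smul_mem_iff _ hn).1 ((hc n).symm ▸ ih hn))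

theorem IsFlow.eq_zero_of_sumsTo_zero (hL : L.IsComplete) (hc : L.IsFlow x u c) (h0 : c 0 = 0)
    (hs : L.SumsTo c 0) : u = 0 := by
  refine (hL p).1 u fun N => ?_
  induction N with
  | zero => exact F_anti (Nat.zero_le 1) _ (mem_F_one u)
  | succ N ih =>
    have c_one : c 1 = u := by simpa [h0] using hc 0
    obtain ⟨n, hn⟩ := ((tendsto_add_atTop_nat 2).eventually (hs (N + 1))).exists
    rw [sub_zero, sum_range_succ', sum_range_succ', h0, c_one, add_zero] at hn
    exact (Submodule.add_mem_iff_right _ (sum_mem fun n _ =>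
      F_anti (by omega) p (hc.mem_F h0 ih (n + 1)))).1 hn

end Flow

theorem bracket_one_comm (h : (1 : ℤ) + 1 = 2) (x y : L.V 1) :
    L.bracket h x y = L.bracket h y x := by
  rw [L.antisymm h h, one_mul, sgn_one, neg_smul, one_smul, neg_neg]

section CauchyBracket

variable {p q r : ℤ} (h : p + q = r) (c c' : ℕ → L.V p) (e : ℕ → L.V q)

theorem cauchyBracket_sub_left (n : ℕ) :
    L.cauchyBracket h (fun i => c i - c' i) e n =
      L.cauchyBracket h c e n - L.cauchyBracket h c' e n := by
  simp only [cauchyBracket, map_sub, LinearMap.sub_apply, sum_sub_distrib]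

theorem cauchyBracket_const_left (u : L.V p) (n : ℕ) :
    L.cauchyBracket h (fun i => if i = 0 then u else 0) e n = L.bracket h u (e n) := by
  rw [cauchyBracket, sum_eq_single_of_mem (0, n) (mem_antidiagonal.2 (zero_add n)), if_pos rfl]
  rintro ⟨i, j⟩ hij hne
  have hi : i ≠ 0 := by rintro rfl; exact hne (by simpa using hij)
  rw [if_neg hi, map_zero, LinearMap.zero_apply]

theorem cauchyBracket_one_comm (h : (1 : ℤ) + 1 = 2) (c e : ℕ → L.V 1) (n : ℕ) :
    L.cauchyBracket h c e n = L.cauchyBracket h e c n := by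
  rw [cauchyBracket, ← Nat.sum_antidiagonal_swap]
  exact sum_congr rfl fun ij _ => bracket_one_comm h _ _

theorem succ_smul_cauchyBracket (n : ℕ) :
    ((n + 1 : ℕ) : k) • L.cauchyBracket h c e (n + 1) =
      L.cauchyBracket h (fun i => ((i + 1 : ℕ) : k) • c (i + 1)) e n +
        L.cauchyBracket h c (fun j => ((j + 1 : ℕ) : k) • e (j + 1)) n := by
  have split : ((n + 1 : ℕ) : k) • L.cauchyBracket h c e (n + 1) =
      L.cauchyBracket h (fun i => (i : k) • c i) e (n + 1) +
        L.cauchyBracket h c (fun j => (j : k) • e j) (n + 1) := by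
    simp only [cauchyBracket, smul_sum, ← sum_add_distrib]
    refine sum_congr rfl fun ij hij => ?_
    rw [← mem_antidiagonal.1 hij, Nat.cast_add, add_smul, map_smul, map_smul, LinearMap.smul_apply]
  rw [split, cauchyBracket, cauchyBracket, Nat.sum_antidiagonal_succ, Nat.sum_antidiagonal_succ']
  simp [cauchyBracket]

theorem bracket_cauchyBracket (x : L.V 0) (n : ℕ) :
    L.bracket (zero_add r) x (L.cauchyBracket h c e n) =
      L.cauchyBracket h (fun i => L.bracket (zero_add p) x (c i)) e n +
        L.cauchyBracket h c (fun j => L.bracket (zero_add q) x (e j)) n := by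
  simp only [cauchyBracket, map_sum, ← sum_add_distrib]
  refine sum_congr rfl fun ij _ => ?_
  rw [L.jacobi h (zero_add r) (zero_add p) h (zero_add q) h, zero_mul, sgn_zero, one_smul]

end CauchyBracket

end GradedLie

namespace DerLie

variable {k : Type u} [Field k] {L M : DerLie k}

theorem d_mem_F_of_isBracketing {n : ℕ} {p : ℤ} {x : L.V p} (hx : L.IsBracketing n x) {q : ℤ}
    (h : p + 1 = q) : L.d h x ∈ L.F n q := by
  induction hx generalizing q with
  | elem x => exact GradedLie.mem_F_one _
  | bracket h' hx hy ihx ihy =>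
    rw [L.leibniz h' h rfl (by omega) rfl (by omega)]
    exact add_mem (GradedLie.bracket_mem_F _ (ihx rfl) hy.mem_F)
      (Submodule.smul_mem _ _ (GradedLie.bracket_mem_F _ hx.mem_F (ihy rfl)))

theorem d_mem_F {n : ℕ} {p q : ℤ} (h : p + 1 = q) {x : L.V p} (hx : x ∈ L.F n p) :
    L.d h x ∈ L.F n q := by
  suffices L.F n p ≤ (L.F n q).comap (L.d h) from this hx
  refine Submodule.span_le.2 ?_
  rintro x ⟨m, hm, hx⟩
  exact GradedLie.F_anti hm q (d_mem_F_of_isBracketing hx h)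

theorem IsMaurerCartan.d_eq {a : L.V 1} (ha : L.IsMaurerCartan a) (h : (1 : ℤ) + 1 = 2) :
    L.d h a = -((2 : k)⁻¹ • L.bracket h a a) :=
  eq_neg_of_add_eq_zero_left ha

theorem isGauge_iff {x : L.V 0} {a b : L.V 1} : L.IsGauge x a b ↔
    ∃ c, c 0 = a ∧ L.IsFlow x (L.d (zero_add 1) x) c ∧ L.SumsTo c b := by
  constructor
  · rintro ⟨c, h0, hc, -, hs⟩
    exact ⟨c, h0, hc, fun N => Filter.eventually_atTop.2 (hs N)⟩
  · rintro ⟨c, h0, hc, hs⟩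
    exact ⟨c, h0, hc, fun N => Filter.eventually_atTop.1 (hs.eventually_mem_F N),
      fun N => Filter.eventually_atTop.1 (hs N)⟩

/-- The curvature `dc(t) + ½[c(t), c(t)]` of the power series with coefficients `c`. -/
def curvature (L : DerLie k) (c : ℕ → L.V 1) (n : ℕ) : L.V 2 :=
  L.d one_add_one_eq_two (c n) + (2 : k)⁻¹ • L.cauchyBracket one_add_one_eq_two c c n

theorem sumsTo_curvature {c : ℕ → L.V 1} {a : L.V 1} (hc : L.SumsTo c a) :
    L.SumsTo (L.curvature c)
      (L.d one_add_one_eq_two a + (2 : k)⁻¹ • L.bracket one_add_one_eq_two a a) :=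
  (hc.map (d_mem_F one_add_one_eq_two)).add ((hc.cauchyBracket one_add_one_eq_two hc).smul _)

variable [CharZero k]

theorem isFlow_curvature {x : L.V 0} {c : ℕ → L.V 1}
    (hc : L.IsFlow x (L.d (zero_add 1) x) c) :
    L.IsFlow x (L.d one_add_one_eq_two (L.d (zero_add 1) x)) (L.curvature c) := fun n => by
  set h := one_add_one_eq_two (R := ℤ)
  set u := L.d (zero_add 1) x
  set adc := fun i => L.bracket (zero_add 1) x (c i)
  have derivative_d : ((n + 1 : ℕ) : k) • L.d h (c (n + 1)) = (if n = 0 then L.d h u else 0) -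
      (L.bracket h u (c n) + L.bracket (zero_add 2) x (L.d h (c n))) := by
    rw [← map_smul, hc, map_sub, L.leibniz _ h (zero_add 1) h h (zero_add 2), sgn_zero, one_smul,
      apply_ite (L.d h), map_zero]
  have derivative_bracket : ((n + 1 : ℕ) : k) • L.cauchyBracket h c c (n + 1) =
      (2 : k) • (L.bracket h u (c n) - L.cauchyBracket h adc c n) := by
    rw [GradedLie.succ_smul_cauchyBracket, GradedLie.cauchyBracket_one_comm h c, ← two_smul k,
      funext hc, GradedLie.cauchyBracket_sub_left, GradedLie.cauchyBracket_const_left]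
  have ad_bracket : L.bracket (zero_add 2) x (L.cauchyBracket h c c n) =
      (2 : k) • L.cauchyBracket h adc c n := by
    rw [GradedLie.bracket_cauchyBracket, GradedLie.cauchyBracket_one_comm h c, ← two_smul k]
  rw [curvature, curvature, smul_add, derivative_d, smul_comm, derivative_bracket, map_add,
    map_smul, ad_bracket, inv_smul_smul₀ two_ne_zero, inv_smul_smul₀ two_ne_zero]
  abel

theorem IsGauge.d_d_eq_zero {x : L.V 0} {a b : L.V 1} (hx : L.IsGauge x a b) (hL : L.IsComplete)
    (ha : L.IsMaurerCartan a) (hb : L.IsMaurerCartan b) :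
    L.d one_add_one_eq_two (L.d (zero_add 1) x) = 0 := by
  obtain ⟨c, rfl, hc, hs⟩ := isGauge_iff.1 hx
  refine (isFlow_curvature hc).eq_zero_of_sumsTo_zero hL ?_ (hb ▸ sumsTo_curvature hs)
  simp only [curvature, GradedLie.cauchyBracket, Finset.Nat.antidiagonal_zero, Finset.sum_singleton]
  exact ha

theorem IsGauge.map_d {x : L.V 0} {a b : L.V 1} (hx : L.IsGauge x a b) (hM : M.IsComplete)
    (φ : GradedLie.Hom L.toGradedLie M.toGradedLie)
    (hy : M.IsGauge (φ.f 0 x) (φ.f 1 a) (φ.f 1 b)) :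
    φ.f 1 (L.d (zero_add 1) x) = M.d (zero_add 1) (φ.f 0 x) := by
  obtain ⟨c, c0, hc, hcs⟩ := isGauge_iff.1 hx
  obtain ⟨e, e0, he, hes⟩ := isGauge_iff.1 hy
  refine sub_eq_zero.1 (((hc.map φ).sub he).eq_zero_of_sumsTo_zero hM ?_ ?_)
  · rw [c0, e0, sub_self]
  · simpa using (hcs.map φ.map_mem_F).sub hes

end DerLie

/-- The graded commutator `a b - (-1)ⁿ b a`, where `n` is the product of the two degrees. -/
def gradedComm (k : Type u) [Field k] (A : Type*) [Ring A] [Algebra k A] (n : ℤ) :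
    A →ₗ[k] A →ₗ[k] A :=
  LinearMap.mul k A - sgn k n • (LinearMap.mul k A).flip

theorem gradedComm_apply {k : Type u} [Field k] {A : Type*} [Ring A] [Algebra k A] (n : ℤ)
    (a b : A) : gradedComm k A n a b = a * b - sgn k n • (b * a) := rfl

section FreeLie

open Finset

variable {k : Type u} [Field k] {I : Type} {deg : I → ℤ} {p q r : ℤ}

/-- The component of word length `n` of an element of the free complete graded Lie algebra. -/
noncomputable def lieCoeff (n : ℕ) : (freeLie k deg).V p →ₗ[k] FreeAlgebra k I where
  toFun F := PowerSeries.coeff n F.1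
  map_add' F G := map_add (PowerSeries.coeff n) F.1 G.1
  map_smul' c F := coeff_smul' c n F.1

theorem lieCoeff_mem (n : ℕ) (F : (freeLie k deg).V p) : lieCoeff n F ∈ liePoly k deg n p :=
  F.2 n

theorem lieCoeff_ext {F G : (freeLie k deg).V p} (h : ∀ n, lieCoeff n F = lieCoeff n G) : F = G :=
  Subtype.ext (PowerSeries.ext h)

theorem lieCoeff_zero_left (F : (freeLie k deg).V p) : lieCoeff 0 F = 0 := by
  simpa only [liePoly_zero, Submodule.mem_bot] using lieCoeff_mem 0 F

theorem lieCoeff_bracket (h : p + q = r) (F : (freeLie k deg).V p) (G : (freeLie k deg).V q)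
    (n : ℕ) : lieCoeff n ((freeLie k deg).bracket h F G) =
      ∑ ij ∈ antidiagonal n, gradedComm k _ (p * q) (lieCoeff ij.1 F) (lieCoeff ij.2 G) := by
  change PowerSeries.coeff n (F.1 * G.1 - sgn k (p * q) • (G.1 * F.1)) = _
  rw [map_sub, coeff_smul', PowerSeries.coeff_mul, PowerSeries.coeff_mul,
    ← Nat.sum_antidiagonal_swap (f := fun ij => PowerSeries.coeff ij.1 G.1 * _), smul_sum,
    ← sum_sub_distrib]
  rfl

/-- The element of the free complete graded Lie algebra with prescribed components. -/
noncomputable def lieSeries (g : ∀ n, liePoly k deg n p) : (freeLie k deg).V p :=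
  ⟨PowerSeries.mk fun n => g n, fun n => by rw [PowerSeries.coeff_mk]; exact (g n).2⟩

theorem lieCoeff_lieSeries (g : ∀ n, liePoly k deg n p) (n : ℕ) : lieCoeff n (lieSeries g) = g n :=
  PowerSeries.coeff_mk n fun n => (g n).1

/-- A Lie polynomial of word length `n` as an element of the free complete graded Lie algebra. -/
noncomputable def lieMonomial (n : ℕ) : liePoly k deg n p →ₗ[k] (freeLie k deg).V p where
  toFun a := ⟨PowerSeries.monomial n a.1, fun m => by
    rw [PowerSeries.coeff_monomial]
    split_ifs with h
    · exact h ▸ a.2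
    · exact zero_mem _⟩
  map_add' a b := Subtype.ext (map_add _ a.1 b.1)
  map_smul' c a := Subtype.ext (smul_monomial c n a.1).symm

theorem lieCoeff_lieMonomial (m n : ℕ) (a : liePoly k deg n p) :
    lieCoeff m (lieMonomial n a) = if m = n then a.1 else 0 :=
  PowerSeries.coeff_monomial m n a.1

theorem bracket_lieMonomial {m n : ℕ} (a : liePoly k deg m p) (b : liePoly k deg n q) :
    (freeLie k deg).bracket rfl (lieMonomial m a) (lieMonomial n b) =
      lieMonomial (m + n) ⟨gradedComm k _ (p * q) a.1 b.1, liePoly_bracket deg a.2 b.2⟩ := by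
  refine Subtype.ext ?_
  change PowerSeries.monomial m a.1 * PowerSeries.monomial n b.1 -
    sgn k (p * q) • (PowerSeries.monomial n b.1 * PowerSeries.monomial m a.1) =
      PowerSeries.monomial (m + n) (a.1 * b.1 - sgn k (p * q) • (b.1 * a.1))
  rw [PowerSeries.monomial_mul_monomial, PowerSeries.monomial_mul_monomial, smul_monomial,
    add_comm n, map_sub]

theorem treeLie_mem (t : FreeMagma I) : treeLie k deg t ∈ liePoly k deg t.length (treeDeg deg t) :=
  Submodule.subset_span ⟨t, rfl, rfl, rfl⟩

theorem lieCoeff_lieGen (i : I) (n : ℕ) :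
    lieCoeff n (lieGen k deg i) = if n = 1 then FreeAlgebra.ι k i else 0 :=
  PowerSeries.coeff_monomial n 1 _

theorem lieCoeff_succ_bracket_lieGen (i : I) (h : deg i + q = r) (G : (freeLie k deg).V q) (n : ℕ) :
    lieCoeff (n + 1) ((freeLie k deg).bracket h (lieGen k deg i) G) =
      gradedComm k _ (deg i * q) (FreeAlgebra.ι k i) (lieCoeff n G) := by
  rw [lieCoeff_bracket, sum_eq_single_of_mem (1, n) (mem_antidiagonal.2 (add_comm 1 n)),
    lieCoeff_lieGen, if_pos rfl]
  rintro ⟨l, m⟩ hlm hne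
  have hl : l ≠ 1 := by
    rintro rfl
    exact hne (Prod.ext rfl (by simpa [add_comm] using hlm))
  rw [lieCoeff_lieGen, if_neg hl, map_zero, LinearMap.zero_apply]

theorem lieCoeff_eq_zero_of_isBracketing {n : ℕ} {F : (freeLie k deg).V p}
    (hF : (freeLie k deg).IsBracketing n F) : ∀ m < n, lieCoeff m F = 0 := by
  induction hF with
  | elem F =>
    intro m hm
    rw [Nat.lt_one_iff.1 hm, lieCoeff_zero_left]
  | @bracket m n _ _ _ h x y _ _ hx hy =>
    intro l hl
    rw [lieCoeff_bracket]
    refine sum_eq_zero fun ij hij => ?_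
    have hij := mem_antidiagonal.1 hij
    by_cases hm : ij.1 < m
    · rw [hx _ hm, map_zero, LinearMap.zero_apply]
    · rw [hy ij.2 (by omega), map_zero]

theorem lieCoeff_eq_zero_of_mem_F {m n : ℕ} (hm : m < n) {F : (freeLie k deg).V p}
    (hF : F ∈ (freeLie k deg).F n p) : lieCoeff m F = 0 := by
  suffices (freeLie k deg).F n p ≤ LinearMap.ker (lieCoeff m) from this hF
  refine Submodule.span_le.2 ?_
  rintro F ⟨l, hl, hF⟩
  exact lieCoeff_eq_zero_of_isBracketing hF m (hm.trans_le hl)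

variable (k deg) in
/-- The span of the brackets, of degree `p`, of a generator with a Lie polynomial of word length
`n`. -/
def genBracket (n : ℕ) (p : ℤ) : Submodule k (FreeAlgebra k I) :=
  ⨆ i, (liePoly k deg n (p - deg i)).map
    (gradedComm k _ (deg i * (p - deg i)) (FreeAlgebra.ι k i))

theorem gradedComm_ι_mem {n : ℕ} {b : FreeAlgebra k I} (hb : b ∈ liePoly k deg n q) (i : I) :
    gradedComm k _ (deg i * q) (FreeAlgebra.ι k i) b ∈ genBracket k deg n (deg i + q) := by
  refine Submodule.mem_iSup_of_mem i ?_
  rw [add_sub_cancel_left]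
  exact Submodule.mem_map_of_mem hb

theorem gradedComm_gradedComm {A : Type*} [Ring A] [Algebra k A] (a b c : A) :
    gradedComm k A ((p + q) * r) (gradedComm k A (p * q) a b) c =
      gradedComm k A (p * (q + r)) a (gradedComm k A (q * r) b c) -
        sgn k (p * q) • gradedComm k A (q * (p + r)) b (gradedComm k A (p * r) a c) := by
  simp only [gradedComm_apply, add_mul, mul_add, sgn_add, mul_comm q p]
  rcases sgn_eq k (p * q) with h | h <;> rcases sgn_eq k (p * r) with h' | h' <;>
    rcases sgn_eq k (q * r) with h'' | h'' <;>
    simp only [h, h', h'', one_smul, neg_smul, mul_one, mul_neg, neg_neg] <;> noncomm_ring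

theorem gradedComm_treeLie_mem (s : FreeMagma I) {n : ℕ} {b : FreeAlgebra k I}
    (hb : b ∈ liePoly k deg n q) : gradedComm k _ (treeDeg deg s * q) (treeLie k deg s) b ∈
      genBracket k deg (s.length + n - 1) (treeDeg deg s + q) := by
  induction s generalizing n q b with
  | ih1 i =>
    rw [show (FreeMagma.of i).length + n - 1 = n from Nat.add_sub_cancel_left 1 n]
    exact gradedComm_ι_mem hb i
  | ih2 s t hs ht =>
    have hst := hs (liePoly_bracket deg (treeLie_mem t) hb)
    have hts := ht (liePoly_bracket deg (treeLie_mem s) hb)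
    have length_mul : (s * t).length = s.length + t.length := rfl
    have := s.length_pos
    have := t.length_pos
    rw [show s.length + (t.length + n) - 1 = (s * t).length + n - 1 by omega,
      show treeDeg deg s + (treeDeg deg t + q) = treeDeg deg (s * t) + q by
        rw [treeDeg_mul, add_assoc]] at hst
    rw [show t.length + (s.length + n) - 1 = (s * t).length + n - 1 by omega,
      show treeDeg deg t + (treeDeg deg s + q) = treeDeg deg (s * t) + q by
        rw [treeDeg_mul, add_assoc, add_left_comm]] at hts
    convert sub_mem hst (Submodule.smul_mem _ (sgn k (treeDeg deg s * treeDeg deg t)) hts) using 1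
    exact gradedComm_gradedComm _ _ _

theorem liePoly_le_genBracket (n : ℕ) (p : ℤ) :
    liePoly k deg (n + 2) p ≤ genBracket k deg (n + 1) p := by
  refine Submodule.span_le.2 ?_
  rintro _ ⟨t, ht, rfl, rfl⟩
  cases t with
  | of i => simp [FreeMagma.length] at ht
  | mul s t =>
    have length_eq : s.length + t.length - 1 = n + 1 := by
      change s.length + t.length = n + 2 at ht
      omega
    exact length_eq ▸ gradedComm_treeLie_mem s (treeLie_mem (k := k) t)

theorem exists_eq_sum_gradedComm_ι [Fintype I] {n : ℕ} {a : FreeAlgebra k I}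
    (ha : a ∈ liePoly k deg (n + 2) p) : ∃ g : ∀ i, liePoly k deg (n + 1) (p - deg i),
      a = ∑ i, gradedComm k _ (deg i * (p - deg i)) (FreeAlgebra.ι k i) (g i) := by
  obtain ⟨f, hf, rfl⟩ :=
    (Submodule.mem_iSup_iff_exists_finsupp _ _).1 (liePoly_le_genBracket n p ha)
  choose g hg hgf using hf
  refine ⟨fun i => ⟨g i, hg i⟩, ?_⟩
  rw [Finsupp.sum_fintype _ _ fun _ => rfl]
  exact sum_congr rfl fun i _ => (hgf i).symm

theorem exists_eq_sum_bracket_lieGen [Fintype I] {n : ℕ} (hn : 0 < n) (F : (freeLie k deg).V p)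
    (hF : ∀ m ≤ n, lieCoeff m F = 0) : ∃ G : ∀ i, (freeLie k deg).V (p - deg i),
      (∀ i, ∀ m < n, lieCoeff m (G i) = 0) ∧
        F = ∑ i, (freeLie k deg).bracket (add_sub_cancel _ _) (lieGen k deg i) (G i) := by
  have coefficients (m : ℕ) : ∃ g : ∀ i, liePoly k deg m (p - deg i),
      (m < n → g = 0) ∧ lieCoeff (m + 1) F =
        ∑ i, gradedComm k _ (deg i * (p - deg i)) (FreeAlgebra.ι k i) (g i) := by
    by_cases hm : m < n
    · exact ⟨0, fun _ => rfl, by simp [hF (m + 1) hm]⟩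
    · obtain ⟨l, rfl⟩ := Nat.exists_eq_succ_of_ne_zero (by omega : m ≠ 0)
      obtain ⟨g, hg⟩ := exists_eq_sum_gradedComm_ι (lieCoeff_mem (l + 2) F)
      exact ⟨g, fun h => absurd h hm, hg⟩
  choose g hg_zero hg using coefficients
  refine ⟨fun i => lieSeries fun m => g m i, fun i m hm => ?_, lieCoeff_ext fun m => ?_⟩
  · rw [lieCoeff_lieSeries, hg_zero m hm, Pi.zero_apply, Submodule.coe_zero]
  · rw [map_sum]
    cases m with
    | zero => simp only [lieCoeff_zero_left, sum_const_zero]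
    | succ m => simp only [lieCoeff_succ_bracket_lieGen, lieCoeff_lieSeries, hg]

section Finite

variable [Finite I]

theorem mem_F_of_lieCoeff_eq_zero {n : ℕ} (F : (freeLie k deg).V p)
    (hF : ∀ m < n, lieCoeff m F = 0) : F ∈ (freeLie k deg).F n p := by
  cases nonempty_fintype I
  induction n generalizing p with
  | zero => exact GradedLie.F_anti (Nat.zero_le 1) _ (GradedLie.mem_F_one F)
  | succ n ih =>
    rcases Nat.eq_zero_or_pos n with rfl | hn
    · exact GradedLie.mem_F_one F
    obtain ⟨G, hG, rfl⟩ := exists_eq_sum_bracket_lieGen hn F fun m hm => hF m (by omega)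
    refine Submodule.sum_mem _ fun i _ => ?_
    rw [add_comm n]
    exact GradedLie.bracket_mem_F _ (GradedLie.mem_F_one _) (ih _ (hG i))

theorem mem_F_iff {n : ℕ} {F : (freeLie k deg).V p} :
    F ∈ (freeLie k deg).F n p ↔ ∀ m < n, lieCoeff m F = 0 :=
  ⟨fun hF _ hm => lieCoeff_eq_zero_of_mem_F hm hF, mem_F_of_lieCoeff_eq_zero F⟩

theorem freeLie_isComplete : (freeLie k deg).IsComplete := by
  refine fun p => ⟨fun F hF => lieCoeff_ext fun m => ?_, fun s hs => ?_⟩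
  · rw [lieCoeff_eq_zero_of_mem_F m.lt_succ_self (hF (m + 1)), map_zero]
  · have stable {m n : ℕ} (hmn : m < n) : lieCoeff m (s n) = lieCoeff m (s (m + 1)) := by
      induction n, hmn using Nat.le_induction with
      | base => rfl
      | succ n hn ih => rw [← ih, ← sub_eq_zero, ← map_sub, lieCoeff_eq_zero_of_mem_F hn (hs n)]
    refine ⟨lieSeries fun m => ⟨_, lieCoeff_mem m (s (m + 1))⟩, fun n => mem_F_iff.2 fun m hm => ?_⟩
    rw [map_sub, lieCoeff_lieSeries, stable hm, sub_self]

theorem sumsTo_lieMonomial (F : (freeLie k deg).V p) :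
    (freeLie k deg).SumsTo (fun n => lieMonomial n ⟨_, lieCoeff_mem n F⟩) F := fun N => by
  filter_upwards [Filter.eventually_ge_atTop N] with n hn
  refine mem_F_iff.2 fun m hm => ?_
  rw [map_sub, map_sum, sum_eq_single_of_mem m (mem_range.2 (hm.trans_le hn)) fun l _ hl => by
    rw [lieCoeff_lieMonomial, if_neg hl.symm], lieCoeff_lieMonomial, if_pos rfl, sub_self]

end Finite

theorem lieMonomial_mem_of_bracket_closed (K : ∀ p, Submodule k ((freeLie k deg).V p))
    (hgen : ∀ i, lieGen k deg i ∈ K (deg i))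
    (hbr : ∀ {p q r : ℤ} (h : p + q = r) (x : (freeLie k deg).V p) (y : (freeLie k deg).V q),
      x ∈ K p → y ∈ K q → (freeLie k deg).bracket h x y ∈ K r)
    {n : ℕ} : ∀ a : liePoly k deg n p, lieMonomial n a ∈ K p := by
  suffices ⊤ ≤ (K p).comap (lieMonomial n) from fun _ => this trivial
  refine Submodule.span_span_coe_preimage.ge.trans (Submodule.span_le.2 ?_)
  rintro ⟨_, _⟩ ⟨t, rfl, rfl, rfl⟩
  induction t with
  | ih1 i => exact hgen i
  | ih2 s t hs ht =>
    change lieMonomial (s.length + t.length) _ ∈ K (treeDeg deg s + treeDeg deg t)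
    have := hbr rfl _ _ (hs (treeLie_mem s)) (ht (treeLie_mem t))
    have bracket_eq := bracket_lieMonomial (k := k) (deg := deg)
      ⟨_, treeLie_mem s⟩ ⟨_, treeLie_mem t⟩
    exact bracket_eq ▸ this

theorem eq_zero_of_eq_zero_on_gen [Finite I] {M : GradedLie k} (hM : M.IsComplete) {σ : ℤ → ℤ}
    (T : ∀ p, (freeLie k deg).V p →ₗ[k] M.V (σ p)) (hgen : ∀ i, T _ (lieGen k deg i) = 0)
    (hbr : ∀ {p q r : ℤ} (h : p + q = r) (x : (freeLie k deg).V p) (y : (freeLie k deg).V q),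
      T p x = 0 → T q y = 0 → T r ((freeLie k deg).bracket h x y) = 0)
    (hF : ∀ {n p} {x : (freeLie k deg).V p}, x ∈ (freeLie k deg).F n p → T p x ∈ M.F n (σ p))
    (x : (freeLie k deg).V p) : T p x = 0 := by
  have monomial_zero (n : ℕ) : T p (lieMonomial n ⟨_, lieCoeff_mem n x⟩) = 0 :=
    lieMonomial_mem_of_bracket_closed (fun p => LinearMap.ker (T p)) hgen hbr _
  have := (sumsTo_lieMonomial x).map hF
  simp only [monomial_zero] at this
  exact this.unique hM (GradedLie.SumsTo.single (m := 0) fun _ _ => rfl)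

end FreeLie

namespace GradedLie

variable {k : Type u} [Field k] {L M : GradedLie k} {p q : ℤ}

/-- The adjoint action of a homogeneous element on the product of all components. -/
def adPi (M : GradedLie k) {p : ℤ} : M.V p →ₗ[k] Module.End k (∀ r, M.V r) where
  toFun x := LinearMap.pi fun r => M.bracket (add_sub_cancel p r) x ∘ₗ LinearMap.proj (r - p)
  map_add' x y := by ext f r; simp
  map_smul' c x := by ext f r; simp

theorem adPi_apply {r : ℤ} (h : p + q = r) (x : M.V p) (f : ∀ r, M.V r) :
    M.adPi x f r = M.bracket h x (f q) := by
  obtain rfl : q = r - p := by omega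
  rfl

theorem adPi_single (x : M.V p) (y : M.V q) :
    M.adPi x (Pi.single q y) = Pi.single (p + q) (M.bracket rfl x y) := by
  ext r
  by_cases h : r = p + q
  · subst h
    rw [adPi_apply rfl, Pi.single_eq_same, Pi.single_eq_same]
  · rw [adPi_apply (add_sub_cancel p r), Pi.single_eq_of_ne h, Pi.single_eq_of_ne (by omega),
      map_zero]

theorem single_bracket_swap (x : M.V p) (y : M.V q) :
    (Pi.single (q + p) (M.bracket rfl y x) : ∀ r, M.V r) =
      -(sgn k (p * q) • Pi.single (p + q) (M.bracket rfl x y)) := by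
  rw [M.antisymm rfl (add_comm p q), mul_comm q, ← adPi_single, Pi.single_neg, Pi.single_smul]
  congr 2
  ext r
  by_cases h : r = q + p
  · subst h
    rw [adPi_apply (add_comm p q), Pi.single_eq_same, Pi.single_eq_same]
  · rw [adPi_single, Pi.single_eq_of_ne h, Pi.single_eq_of_ne (by omega)]

theorem adPi_bracket (x : M.V p) (y : M.V q) (f : ∀ r, M.V r) :
    M.adPi (M.bracket rfl x y) f =
      M.adPi x (M.adPi y f) - sgn k (p * q) • M.adPi y (M.adPi x f) := by
  ext r
  have hpq : p + (q + (r - p - q)) = r := by omega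
  have hqp : q + (p + (r - p - q)) = r := by omega
  have hr : p + q + (r - p - q) = r := by omega
  rw [Pi.sub_apply, Pi.smul_apply, adPi_apply hr, adPi_apply hpq, adPi_apply rfl, adPi_apply hqp,
    adPi_apply rfl, M.jacobi rfl hpq rfl hr rfl hqp, add_sub_cancel_right]

/-- Composition of morphisms of graded Lie algebras. -/
def Hom.comp {N : GradedLie k} (ψ : Hom M N) (φ : Hom L M) : Hom L N where
  f p := ψ.f p ∘ₗ φ.f p
  map_bracket h x y := by
    rw [LinearMap.comp_apply, φ.map_bracket, ψ.map_bracket, LinearMap.comp_apply,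
      LinearMap.comp_apply]

/-- The identity morphism of a graded Lie algebra. -/
def Hom.id (L : GradedLie k) : Hom L L where
  f _ := LinearMap.id
  map_bracket _ _ _ := rfl

theorem IsFreeCompleteOn.comp_eq_id {I : Type} {deg : I → ℤ} {g : ∀ i, L.V (deg i)}
    {g' : ∀ i, M.V (deg i)} (hL : L.IsFreeCompleteOn deg g) {φ : Hom L M} {ψ : Hom M L}
    (hφ : ∀ i, φ.f (deg i) (g i) = g' i) (hψ : ∀ i, ψ.f (deg i) (g' i) = g i) :
    ψ.comp φ = Hom.id L :=
  (hL.2 L hL.1 g).unique (fun i => (congrArg (ψ.f _) (hφ i)).trans (hψ i)) fun _ => rfl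

theorem IsFreeCompleteOn.bijective {I : Type} {deg : I → ℤ} {g : ∀ i, L.V (deg i)}
    {g' : ∀ i, M.V (deg i)} (hL : L.IsFreeCompleteOn deg g) (hM : M.IsFreeCompleteOn deg g')
    {φ : Hom L M} (hφ : ∀ i, φ.f (deg i) (g i) = g' i) (p : ℤ) : Function.Bijective (φ.f p) := by
  obtain ⟨ψ, hψ, -⟩ := hM.2 L hL.1 g
  refine Function.bijective_iff_has_inverse.2 ⟨ψ.f p, fun x => ?_, fun x => ?_⟩
  · exact congrArg (fun χ : Hom L L => χ.f p x) (hL.comp_eq_id hφ hψ)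
  · exact congrArg (fun χ : Hom M M => χ.f p x) (hM.comp_eq_id hψ hφ)

end GradedLie

section Evaluation

variable {k : Type u} [Field k] {I : Type} {deg : I → ℤ} {M : GradedLie k} (y : ∀ i, M.V (deg i))
  {p q : ℤ}

/-- The value of a bracketing of generators in a graded Lie algebra. -/
def treeEval : ∀ t : FreeMagma I, M.V (treeDeg deg t)
  | .of i => y i
  | .mul s t => M.bracket rfl (treeEval s) (treeEval t)

theorem treeEval_mem_F (t : FreeMagma I) : treeEval y t ∈ M.F t.length _ := by
  induction t with
  | ih1 i => exact GradedLie.mem_F_one _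
  | ih2 s t hs ht => exact GradedLie.bracket_mem_F _ hs ht

/-- The action of the generators on `k × M` by `(c, f) ↦ (0, c yᵢ + [yᵢ, f])`. Applied to
`(1, 0)`, a word of generators gives the right-normed bracket of the `yᵢ`. -/
noncomputable def dynkinRep : FreeAlgebra k I →ₐ[k] Module.End k (k × ∀ r, M.V r) :=
  FreeAlgebra.lift k fun i => LinearMap.inr k k _ ∘ₗ
    (LinearMap.toSpanSingleton k _ (Pi.single (deg i) (y i)) ∘ₗ LinearMap.fst k k _ +
      M.adPi (y i) ∘ₗ LinearMap.snd k k _)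

theorem dynkinRep_treeLie (t : FreeMagma I) (c : k) (f : ∀ r, M.V r) :
    dynkinRep y (treeLie k deg t) (c, f) =
      (0, (c * t.length) • Pi.single (treeDeg deg t) (treeEval y t) + M.adPi (treeEval y t) f) := by
  induction t generalizing c f with
  | ih1 i =>
    simp only [dynkinRep, treeLie_of, FreeAlgebra.lift_ι_apply, FreeMagma.length, Nat.cast_one,
      mul_one]
    rfl
  | ih2 s t hs ht =>
    have length_mul : ((s * t).length : k) = s.length + t.length := Nat.cast_add _ _
    have single_mul : (Pi.single (treeDeg deg (s * t)) (treeEval y (s * t)) : ∀ r, M.V r) =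
      Pi.single (treeDeg deg s + treeDeg deg t) (M.bracket rfl (treeEval y s) (treeEval y t)) := rfl
    have adPi_mul : M.adPi (treeEval y (s * t)) f = _ :=
      GradedLie.adPi_bracket (treeEval y s) (treeEval y t) f
    rw [treeLie_mul, map_sub, map_smul, map_mul, map_mul, LinearMap.sub_apply,
      LinearMap.smul_apply, Module.End.mul_apply, Module.End.mul_apply, hs, ht, hs, ht, length_mul,
      single_mul, adPi_mul]
    refine Prod.ext (by simp) ?_
    simp only [Prod.snd_sub, Prod.smul_snd, zero_mul, zero_smul, zero_add, map_add, map_smul,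
      GradedLie.adPi_single, GradedLie.single_bracket_swap (treeEval y s), smul_add, smul_neg,
      mul_add, add_smul]
    rw [smul_comm (sgn k _) (c * (s.length : k)), smul_smul (sgn k _) (sgn k _), sgn_mul_self,
      one_smul]
    abel

/-- The value of a Lie polynomial of word length `n` and degree `p`: by the Dynkin–Specht–Wever
formula, replacing words by right-normed brackets multiplies it by `n`. -/
noncomputable def polyEval (n : ℕ) (p : ℤ) : FreeAlgebra k I →ₗ[k] M.V p :=
  (n : k)⁻¹ • (LinearMap.proj p ∘ₗ LinearMap.snd k k _ ∘ₗ
    LinearMap.applyₗ ((1 : k), (0 : ∀ r, M.V r)) ∘ₗ (dynkinRep y).toLinearMap)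

variable [CharZero k]

theorem polyEval_treeLie (t : FreeMagma I) :
    polyEval y t.length (treeDeg deg t) (treeLie k deg t) = treeEval y t := by
  have length_ne_zero : (t.length : k) ≠ 0 := Nat.cast_ne_zero.2 t.length_pos.ne'
  simp [polyEval, dynkinRep_treeLie, length_ne_zero]

theorem polyEval_mem_F {n : ℕ} {a : FreeAlgebra k I} (ha : a ∈ liePoly k deg n p) :
    polyEval y n p a ∈ M.F n p := by
  suffices liePoly k deg n p ≤ (M.F n p).comap (polyEval y n p) from this ha
  refine Submodule.span_le.2 ?_
  rintro _ ⟨t, rfl, rfl, rfl⟩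
  rw [Submodule.comap_coe, Set.mem_preimage, polyEval_treeLie]
  exact treeEval_mem_F y t

theorem polyEval_gradedComm {m n l : ℕ} {r : ℤ} (hl : m + n = l) (h : p + q = r)
    {a b : FreeAlgebra k I} (ha : a ∈ liePoly k deg m p) (hb : b ∈ liePoly k deg n q) :
    polyEval y l r (gradedComm k _ (p * q) a b) =
      M.bracket h (polyEval y m p a) (polyEval y n q b) := by
  subst hl h
  induction ha, hb using Submodule.span_induction₂ with
  | mem_mem a b ha hb =>
    obtain ⟨s, rfl, rfl, rfl⟩ := ha
    obtain ⟨t, rfl, rfl, rfl⟩ := hb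
    rw [polyEval_treeLie, polyEval_treeLie]
    exact polyEval_treeLie y (s * t)
  | zero_left => simp only [map_zero, LinearMap.zero_apply]
  | zero_right => simp only [map_zero]
  | add_left a a' b _ _ _ ha ha' => simp only [map_add, LinearMap.add_apply, ha, ha']
  | add_right a b b' _ _ _ hb hb' => simp only [map_add, hb, hb']
  | smul_left c a b _ _ h => simp only [map_smul, LinearMap.smul_apply, h]
  | smul_right c a b _ _ h => simp only [map_smul, h]

theorem polyEval_lieCoeff_bracket {r : ℤ} (h : p + q = r) (F : (freeLie k deg).V p)
    (G : (freeLie k deg).V q) (n : ℕ) :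
    polyEval y n r (lieCoeff n ((freeLie k deg).bracket h F G)) =
      M.cauchyBracket h (fun m => polyEval y m p (lieCoeff m F))
        (fun m => polyEval y m q (lieCoeff m G)) n := by
  rw [lieCoeff_bracket, map_sum]
  exact Finset.sum_congr rfl fun ij hij => polyEval_gradedComm y
    (Finset.HasAntidiagonal.mem_antidiagonal.1 hij) h (lieCoeff_mem _ F) (lieCoeff_mem _ G)

theorem exists_sumsTo_polyEval (hM : M.IsComplete) (F : (freeLie k deg).V p) :
    ∃ x, M.SumsTo (fun n => polyEval y n p (lieCoeff n F)) x :=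
  hM.exists_sumsTo fun n => polyEval_mem_F y (lieCoeff_mem n F)

variable (hM : M.IsComplete)

/-- The value of a Lie series in a complete graded Lie algebra. -/
noncomputable def seriesEval (F : (freeLie k deg).V p) : M.V p :=
  (exists_sumsTo_polyEval y hM F).choose

theorem sumsTo_seriesEval (F : (freeLie k deg).V p) :
    M.SumsTo (fun n => polyEval y n p (lieCoeff n F)) (seriesEval y hM F) :=
  (exists_sumsTo_polyEval y hM F).choose_spec

/-- The morphism out of the free complete graded Lie algebra with given values on the
generators. -/
noncomputable def evalHom : GradedLie.Hom (freeLie k deg) M where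
  f p :=
    { toFun := seriesEval y hM
      map_add' := fun F G => (sumsTo_seriesEval y hM (F + G)).unique hM <| by
        simpa only [map_add] using (sumsTo_seriesEval y hM F).add (sumsTo_seriesEval y hM G)
      map_smul' := fun c F => (sumsTo_seriesEval y hM (c • F)).unique hM <| by
        simpa only [map_smul, RingHom.id_apply] using (sumsTo_seriesEval y hM F).smul c }
  map_bracket {p q r} h F G := (sumsTo_seriesEval y hM _).unique hM <| by
    simp only [polyEval_lieCoeff_bracket]
    exact (sumsTo_seriesEval y hM F).cauchyBracket h (sumsTo_seriesEval y hM G)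

theorem evalHom_lieGen (i : I) : (evalHom y hM).f (deg i) (lieGen k deg i) = y i := by
  have hs := GradedLie.SumsTo.single (L := M) (m := 1)
    (c := fun n => polyEval y n (deg i) (lieCoeff n (lieGen k deg i))) fun n hn => by
      rw [lieCoeff_lieGen, if_neg hn, map_zero]
  refine ((sumsTo_seriesEval y hM _).unique hM hs).trans ?_
  rw [lieCoeff_lieGen, if_pos rfl]
  exact polyEval_treeLie y (.of i)

end Evaluation

theorem freeLie_isFreeCompleteOn (k : Type u) [Field k] [CharZero k] {I : Type} [Finite I]
    (deg : I → ℤ) : (freeLie k deg).IsFreeCompleteOn deg (lieGen k deg) := by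
  refine ⟨freeLie_isComplete, fun M hM y => ⟨evalHom y hM, evalHom_lieGen y hM, fun φ hφ => ?_⟩⟩
  refine GradedLie.Hom.ext (funext fun p => LinearMap.ext fun x => sub_eq_zero.1 ?_)
  refine eq_zero_of_eq_zero_on_gen hM (σ := id) (fun p => φ.f p - (evalHom y hM).f p)
    (fun i => ?_) (fun h x z hx hz => ?_) (fun hx => ?_) x
  · exact sub_eq_zero.2 ((hφ i).trans (evalHom_lieGen y hM i).symm)
  · rw [LinearMap.sub_apply, sub_eq_zero] at hx hz ⊢
    rw [φ.map_bracket, GradedLie.Hom.map_bracket]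
    exact congrArg₂ (fun a b => M.bracket h a b) hx hz
  · exact sub_mem (φ.map_mem_F hx) ((evalHom y hM).map_mem_F hx)

namespace DerLie

variable {k : Type u} [Field k] {L M : DerLie k}

theorem d_d_bracket_eq_zero {p q r s t : ℤ} (h : p + q = r) (hs : r + 1 = s) (ht : s + 1 = t)
    (x : L.V p) (y : L.V q) (hx : L.d (rfl : p + 1 + 1 = _) (L.d rfl x) = 0)
    (hy : L.d (rfl : q + 1 + 1 = _) (L.d rfl y) = 0) : L.d ht (L.d hs (L.bracket h x y)) = 0 := by
  rw [L.leibniz h hs rfl (by omega) rfl (by omega), map_add, map_smul,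
    L.leibniz _ ht rfl (by omega) rfl (by omega), hx,
    L.leibniz _ ht rfl (by omega) rfl (by omega), hy]
  simp [sgn_add]

theorem map_d_bracket (φ : GradedLie.Hom L.toGradedLie M.toGradedLie) {p q r t : ℤ}
    (h : p + q = r) (ht : r + 1 = t) (x : L.V p) (y : L.V q)
    (hx : φ.f (p + 1) (L.d rfl x) = M.d rfl (φ.f p x))
    (hy : φ.f (q + 1) (L.d rfl y) = M.d rfl (φ.f q y)) :
    φ.f t (L.d ht (L.bracket h x y)) = M.d ht (φ.f r (L.bracket h x y)) := by
  rw [L.leibniz h ht rfl (by omega) rfl (by omega), map_add, map_smul, φ.map_bracket h,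
    φ.map_bracket, φ.map_bracket, M.leibniz h ht rfl (by omega) rfl (by omega), hx, hy]

theorem IsMaurerCartan.map_d {a : L.V 1} (ha : L.IsMaurerCartan a)
    (φ : GradedLie.Hom L.toGradedLie M.toGradedLie) (hb : M.IsMaurerCartan (φ.f 1 a)) :
    φ.f 2 (L.d one_add_one_eq_two a) = M.d one_add_one_eq_two (φ.f 1 a) := by
  rw [ha.d_eq, hb.d_eq, map_neg, map_smul, φ.map_bracket]

theorem IsMaurerCartan.d_d_eq_zero [CharZero k] {a : L.V 1} (ha : L.IsMaurerCartan a) :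
    L.d two_add_one_eq_three (L.d one_add_one_eq_two a) = 0 := by
  have one_add_two : (1 : ℤ) + 2 = 3 := by norm_num
  set w := L.bracket one_add_one_eq_two a a
  have swap : L.bracket two_add_one_eq_three w a = -L.bracket one_add_two a w := by
    rw [L.antisymm two_add_one_eq_three one_add_two, show (2 : ℤ) * 1 = 1 + 1 by norm_num, sgn_add,
      sgn_mul_self, one_smul]
  have jacobi :
      L.bracket one_add_two a w = -L.bracket one_add_two a w - L.bracket one_add_two a w := by
    have := L.jacobi one_add_one_eq_two one_add_two one_add_one_eq_two two_add_one_eq_three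
      one_add_one_eq_two one_add_two a a a
    rwa [mul_one, sgn_one, neg_one_smul, swap, ← sub_eq_add_neg] at this
  have bracket_eq_zero : L.bracket one_add_two a w = 0 := by
    have three_smul : (3 : k) • L.bracket one_add_two a w = 0 := calc
      _ = L.bracket one_add_two a w -
          (-L.bracket one_add_two a w - L.bracket one_add_two a w) := by module
      _ = 0 := sub_eq_zero.2 jacobi
    exact (smul_eq_zero.1 three_smul).resolve_left three_ne_zero
  rw [ha.d_eq, map_neg, map_smul, L.leibniz one_add_one_eq_two two_add_one_eq_three
    one_add_one_eq_two two_add_one_eq_three one_add_one_eq_two one_add_two, ha.d_eq]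
  simp [swap, bracket_eq_zero, w]

end DerLie

section FreeDerivation

variable {k : Type u} [Field k] {I : Type} [Finite I] {deg : I → ℤ}
  {D : ∀ i, (freeLie k deg).V (deg i + 1)}

theorem freeDerLie_isDGLie
    (hD : ∀ i, (freeDerLie deg D).d (rfl : deg i + 1 + 1 = _)
      ((freeDerLie deg D).d rfl (lieGen k deg i)) = 0) :
    (freeDerLie deg D).IsDGLie := by
  rintro p q r rfl rfl x
  exact eq_zero_of_eq_zero_on_gen freeLie_isComplete (σ := fun p => p + 1 + 1)
    (fun p => (freeDerLie deg D).d rfl ∘ₗ (freeDerLie deg D).d rfl) hD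
    (fun h x z hx hz => DerLie.d_d_bracket_eq_zero (L := freeDerLie deg D) h rfl rfl x z hx hz)
    (fun hx => DerLie.d_mem_F (L := freeDerLie deg D) rfl
      (DerLie.d_mem_F (L := freeDerLie deg D) rfl hx)) x

theorem map_d_of_map_d_lieGen {M : DerLie k} (hM : M.IsComplete)
    (φ : GradedLie.Hom (freeLie k deg) M.toGradedLie)
    (hφ : ∀ i, φ.f (deg i + 1) ((freeDerLie deg D).d rfl (lieGen k deg i)) =
      M.d rfl (φ.f _ (lieGen k deg i))) {p q : ℤ} (h : p + 1 = q)
    (x : (freeLie k deg).V p) : φ.f q ((freeDerLie deg D).d h x) = M.d h (φ.f p x) := by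
  subst h
  let δ (p : ℤ) : (freeLie k deg).V p →ₗ[k] (freeLie k deg).V (p + 1) := (freeDerLie deg D).d rfl
  refine sub_eq_zero.1 (eq_zero_of_eq_zero_on_gen hM (σ := fun p => p + 1)
    (fun p => φ.f (p + 1) ∘ₗ δ p - M.d rfl ∘ₗ φ.f p)
    (fun i => ?_) (fun h x z hx hz => ?_) (fun hx => ?_) x)
  · exact sub_eq_zero.2 (hφ i)
  · exact sub_eq_zero.2 (DerLie.map_d_bracket (L := freeDerLie deg D) φ h rfl x z
      (sub_eq_zero.1 hx) (sub_eq_zero.1 hz))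
  · exact sub_mem (φ.map_mem_F (DerLie.d_mem_F (L := freeDerLie deg D) rfl hx))
      (DerLie.d_mem_F (L := M) rfl (φ.map_mem_F hx))

end FreeDerivation

theorem lieCoeff_bracket_lieGen_lieGen {k : Type u} [Field k] {I : Type} {deg : I → ℤ} {r : ℤ}
    (i j : I) (h : deg i + deg j = r) (n : ℕ) :
    lieCoeff n ((freeLie k deg).bracket h (lieGen k deg i) (lieGen k deg j)) =
      if n = 2 then treeLie k deg (.of i * .of j) else 0 := by
  cases n with
  | zero => exact lieCoeff_zero_left _
  | succ n =>
    rw [lieCoeff_succ_bracket_lieGen, lieCoeff_lieGen]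
    by_cases hn : n = 1
    · rw [if_pos hn, if_pos (congrArg (· + 1) hn)]
      rfl
    · rw [if_neg hn, if_neg (by omega), map_zero]

namespace Contraction

variable {k : Type u} [Field k] {Ω : CDGA k} {I : Type} [Fintype I] [DecidableEq I]
  (c : Contraction Ω I)

theorem p_treeForm (i : I) (T : FreeMagma I) :
    c.p i (c.treeForm T) = if T = .of i then 1 else 0 := by
  cases T with
  | of j =>
    have of_eq_of : i = j ↔ FreeMagma.of j = .of i := ⟨fun h => h ▸ rfl, fun h => by cases h; rfl⟩
    exact (c.p_e i j).trans (if_congr of_eq_of rfl rfl)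
  | mul s t => exact ((map_smul _ _ _).trans (congrArg _ (c.p_h i _))).trans (smul_zero _)

theorem lieCoeff_genD (i : I) (n : ℕ) :
    lieCoeff n (c.genD i) = ∑ T ∈ trees I n, c.treeCoeff i T • treeLie k c.genDeg T :=
  PowerSeries.coeff_mk n fun n => ∑ T ∈ trees I n, c.treeCoeff i T • treeLie k c.genDeg T

variable {c} {i : I} (hi : c.deg i = 0) (hmul : ∀ a b, c.p i (a * b) = c.p i a * c.p i b)
  (hd : ∀ j, c.p i (Ω.d (c.e j)) = 0)

include hi hmul hd

theorem treeCoeff_of_augmentation (T : FreeMagma I) :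
    c.treeCoeff i T = if T = .of i * .of i then -(2 : k)⁻¹ else 0 := by
  cases T with
  | of j =>
    change -(_ * c.p i (Ω.d (c.e j))) = _
    rw [hd, mul_zero, neg_zero]
    rfl
  | mul s t =>
    change -(2⁻¹ * sgn k ((1 - treeDeg c.genDeg s) * treeDeg c.genDeg t) *
      c.p i (c.treeForm s * c.treeForm t)) = if s * t = _ then _ else _
    rw [hmul, p_treeForm, p_treeForm]
    by_cases hst : s * t = .of i * .of i
    · cases hst
      have treeDeg_eq_one : treeDeg c.genDeg (.of i) = 1 := by
        change 1 - c.deg i = 1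
        rw [hi, sub_zero]
      simp [treeDeg_eq_one]
    · rw [if_neg hst, ite_zero_mul_ite_zero, if_neg, mul_zero, neg_zero]
      rintro ⟨rfl, rfl⟩
      exact hst rfl

theorem d_gen_of_augmentation {r : ℤ} (h : c.genDeg i + 1 = r) (h' : c.genDeg i + c.genDeg i = r) :
    c.cobar.d h (c.gen i) = -((2 : k)⁻¹ • c.cobar.bracket h' (c.gen i) (c.gen i)) := by
  subst h
  refine (freeDerLie_d_gen c.genDeg c.genD i).trans (lieCoeff_ext fun n => ?_)
  have lieCoeff_rhs : lieCoeff n (-((2 : k)⁻¹ • (freeLie k c.genDeg).bracket h'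
      (lieGen k c.genDeg i) (lieGen k c.genDeg i))) =
      -((2 : k)⁻¹ • if n = 2 then treeLie k c.genDeg (.of i * .of i) else 0) := by
    rw [map_neg, map_smul, lieCoeff_bracket_lieGen_lieGen]
  refine .trans ?_ lieCoeff_rhs.symm
  have length_eq : (FreeMagma.of i * FreeMagma.of i).length = n ↔ n = 2 := eq_comm
  simp only [lieCoeff_genD, treeCoeff_of_augmentation hi hmul hd, ite_smul, zero_smul,
    Finset.sum_ite_eq', mem_trees, length_eq]
  split_ifs
  · exact neg_smul _ _
  · rw [smul_zero, neg_zero]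

end Contraction

theorem sum_trees_of_support_leaf {I : Type} [Fintype I] [DecidableEq I] {N : Type*}
    [AddCommMonoid N] {e : I} {f : FreeMagma I → N}
    (h : ∀ s t, s ≠ .of e → t ≠ .of e → f (s * t) = 0) (he : f (.of e * .of e) = 0) (n : ℕ) :
    ∑ T ∈ trees I (n + 2), f T =
      ∑ t ∈ trees I (n + 1), (f (.of e * t) + f (t * .of e)) := by
  set left := (trees I (n + 1)).image (FreeMagma.of e * ·)
  set right := (trees I (n + 1)).image (· * FreeMagma.of e)
  have length_leaf : (FreeMagma.of e).length = 1 := rfl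
  have length_mul (s t : FreeMagma I) : (s * t).length = s.length + t.length := rfl
  have subset : left ∪ right ⊆ trees I (n + 2) := by
    refine Finset.union_subset (Finset.image_subset_iff.2 fun t ht => ?_)
      (Finset.image_subset_iff.2 fun t ht => ?_) <;> rw [mem_trees] at ht ⊢ <;>
      rw [length_mul] <;> omega
  have zero_outside : ∀ T ∈ trees I (n + 2), T ∉ left ∪ right → f T = 0 := by
    intro T hT hT'
    rw [mem_trees] at hT
    cases T with
    | of j => cases hT
    | mul s t =>
      have hst : s.length + t.length = n + 2 := hT
      refine h s t ?_ ?_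
      · rintro rfl
        exact hT' (Finset.mem_union_left _ (Finset.mem_image_of_mem _ (mem_trees.2 (by omega))))
      · rintro rfl
        exact hT' (Finset.mem_union_right _ (Finset.mem_image.2 ⟨s, mem_trees.2 (by omega), rfl⟩))
  have zero_inter : ∑ T ∈ left ∩ right, f T = 0 := by
    refine Finset.sum_eq_zero fun T hT => ?_
    obtain ⟨hl, hr⟩ := Finset.mem_inter.1 hT
    obtain ⟨s, -, rfl⟩ := Finset.mem_image.1 hl
    obtain ⟨t, -, hst⟩ := Finset.mem_image.1 hr
    cases hst
    exact he
  rw [← Finset.sum_subset subset zero_outside, ← add_zero (∑ T ∈ left ∪ right, f T), ← zero_inter,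
    Finset.sum_union_inter, Finset.sum_image fun _ _ _ _ h => by cases h; rfl,
    Finset.sum_image fun _ _ _ _ h => by cases h; rfl, Finset.sum_add_distrib]

theorem sum_trees_one {I : Type} [Fintype I] [DecidableEq I] {N : Type*} [AddCommMonoid N]
    (f : FreeMagma I → N) : ∑ T ∈ trees I 1, f T = ∑ i, f (.of i) := by
  rw [trees, Finset.sum_image fun _ _ _ _ h => by cases h; rfl]

section Interval

open Polynomial

variable (k : Type u) [Field k]

/-- Integration of `f dt` over the interval, as a functional of the polynomial `f`. -/
noncomputable def unitIntegral : Module.Dual k k[X] :=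
  leval 1 ∘ₗ antideriv k

/-- The `0`-form that Dupont's homotopy assigns to `f dt`, as a function of the polynomial `f`. -/
noncomputable def homotopyPoly : k[X] →ₗ[k] k[X] :=
  antideriv k - LinearMap.toSpanSingleton k k[X] X ∘ₗ unitIntegral k

theorem leval_zero_comp_homotopyPoly : leval 0 ∘ₗ homotopyPoly k = 0 := by
  ext f
  simp [homotopyPoly, antideriv_eval_zero]

theorem leval_one_comp_homotopyPoly : leval 1 ∘ₗ homotopyPoly k = 0 := by
  ext f
  simp [homotopyPoly, unitIntegral]

variable [CharZero k]

theorem lcoeff_succ_comp_homotopyPoly (n : ℕ) :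
    ((n + 1 : ℕ) : k) • (lcoeff k (n + 1) ∘ₗ homotopyPoly k) =
      lcoeff k n - if n = 0 then unitIntegral k else 0 := by
  refine LinearMap.ext fun f => ?_
  have coeff_antideriv : ((n + 1 : ℕ) : k) * (antideriv k f).coeff (n + 1) = f.coeff n := by
    rw [mul_comm, Nat.cast_succ, ← coeff_derivative, derivative_antideriv]
  simp only [homotopyPoly, LinearMap.smul_apply, LinearMap.comp_apply, LinearMap.sub_apply,
    lcoeff_apply, coeff_sub, smul_eq_mul, mul_sub, coeff_antideriv,
    LinearMap.toSpanSingleton_apply, coeff_smul, coeff_X]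
  cases n <;> simp

/-- The coefficient `f` of the form `f + g dt` attached to a labelled tree. -/
noncomputable def zeroForm (T : FreeMagma Face1) : k[X] :=
  fstL k ((dupont1 k).treeForm T)

/-- The coefficient of `dt` in the product of the forms attached to two labelled trees. -/
noncomputable def mulOneForm (s t : FreeMagma Face1) : k[X] :=
  sndL k ((dupont1 k).treeForm s * (dupont1 k).treeForm t)

variable {k}

theorem zeroForm_eq_zero {T : FreeMagma Face1} (hT : treeDeg (dupont1 k).genDeg T ≠ 1) :
    zeroForm k T = 0 :=
  ((dupont1 k).treeForm_mem T).1 (by omega)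

theorem snd_treeForm_eq_zero {T : FreeMagma Face1} (hT : T ≠ .of .e01) :
    sndL k ((dupont1 k).treeForm T) = 0 := by
  cases T with
  | of j =>
    cases j with
    | v0 => rfl
    | v1 => rfl
    | e01 => exact absurd rfl hT
  | mul s t => exact (map_smul (sndL k) _ _).trans (smul_zero _)

theorem mulOneForm_eq (s t : FreeMagma Face1) :
    mulOneForm k s t = zeroForm k s * sndL k ((dupont1 k).treeForm t) +
      sndL k ((dupont1 k).treeForm s) * zeroForm k t :=
  DualNumber.snd_mul _ _

theorem mulOneForm_eq_zero {s t : FreeMagma Face1} (hs : s ≠ .of .e01) (ht : t ≠ .of .e01) :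
    mulOneForm k s t = 0 := by
  rw [mulOneForm_eq, snd_treeForm_eq_zero hs, snd_treeForm_eq_zero ht, mul_zero, zero_mul,
    add_zero]

theorem mulOneForm_e01_left (t : FreeMagma Face1) :
    mulOneForm k (.of .e01) t = zeroForm k t := by
  rw [mulOneForm_eq]
  change 0 * _ + 1 * _ = _
  rw [zero_mul, one_mul, zero_add]

theorem mulOneForm_e01_right (t : FreeMagma Face1) :
    mulOneForm k t (.of .e01) = zeroForm k t := by
  rw [mulOneForm_eq]
  change _ * 1 + _ * 0 = _
  rw [mul_one, mul_zero, add_zero]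

theorem mulOneForm_eq_zero_of_treeDeg {s t : FreeMagma Face1}
    (h : treeDeg (dupont1 k).genDeg s + treeDeg (dupont1 k).genDeg t ≠ 1) :
    mulOneForm k s t = 0 :=
  ((omega1 k).mul_mem ((dupont1 k).treeForm_mem s) ((dupont1 k).treeForm_mem t)).2 (by omega)

theorem zeroForm_mul (s t : FreeMagma Face1) : zeroForm k (s * t) =
    ((2 : k)⁻¹ * sgn k ((1 - treeDeg (dupont1 k).genDeg s) * treeDeg (dupont1 k).genDeg t)) •
      homotopyPoly k (mulOneForm k s t) := by
  have zeroForm_eq : zeroForm k (s * t) =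
      -((2 : k)⁻¹ * sgn k ((1 - treeDeg (dupont1 k).genDeg s) * treeDeg (dupont1 k).genDeg t +
        (treeDeg (dupont1 k).genDeg s + treeDeg (dupont1 k).genDeg t))) •
      homotopyPoly k (mulOneForm k s t) := rfl
  by_cases h : treeDeg (dupont1 k).genDeg s + treeDeg (dupont1 k).genDeg t = 1
  · rw [zeroForm_eq, h, sgn_add, sgn_one, mul_neg, mul_neg, neg_neg, mul_one]
  · rw [zeroForm_eq, mulOneForm_eq_zero_of_treeDeg h, map_zero, smul_zero, smul_zero]

theorem treeCoeff_e01_mul (s t : FreeMagma Face1) : (dupont1 k).treeCoeff .e01 (s * t) =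
    (2 : k)⁻¹ * sgn k ((1 - treeDeg (dupont1 k).genDeg s) * treeDeg (dupont1 k).genDeg t) *
      (-unitIntegral k) (mulOneForm k s t) :=
  (mul_neg _ _).symm

theorem treeCoeff_e01_of (j : Face1) : (dupont1 k).treeCoeff .e01 (.of j) =
    -(sgn k ((dupont1 k).genDeg j) *
      ((basicForm k j).fst.eval 1 - (basicForm k j).fst.eval 0)) := by
  change -(_ * (antideriv k (derivative (basicForm k j).fst)).eval 1) = _
  rw [antideriv_derivative, eval_sub, eval_C]

variable (k) in
/-- The graded Lie algebra underlying `mc₁`. -/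
noncomputable abbrev mc1Lie : GradedLie k :=
  freeLie k (dupont1 k).genDeg

-- Only trees in which a branch at the root is the leaf `e01` contribute, and the two positions of
-- that leaf contribute equally.
theorem sum_trees_eq_neg_gradedComm {f : FreeMagma Face1 → k} {ℓ : Module.Dual k k[X]}
    (hf : ∀ s t, f (s * t) = (2 : k)⁻¹ *
      sgn k ((1 - treeDeg (dupont1 k).genDeg s) * treeDeg (dupont1 k).genDeg t) *
        ℓ (mulOneForm k s t)) (n : ℕ) :
    ∑ T ∈ trees Face1 (n + 2), f T • treeLie k (dupont1 k).genDeg T =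
      -gradedComm k _ 0 (FreeAlgebra.ι k .e01)
        (∑ t ∈ trees Face1 (n + 1), ℓ (zeroForm k t) • treeLie k (dupont1 k).genDeg t) := by
  have treeDeg_e01 : treeDeg (dupont1 k).genDeg (.of .e01) = 0 := rfl
  rw [sum_trees_of_support_leaf (e := .e01), map_sum, ← Finset.sum_neg_distrib]
  · refine Finset.sum_congr rfl fun t _ => ?_
    rw [hf, hf, mulOneForm_e01_left, mulOneForm_e01_right, treeDeg_e01, treeLie_mul, treeLie_mul,
      treeDeg_e01, map_smul, gradedComm_apply, zero_mul, mul_zero, sgn_zero, one_smul, one_smul]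
    by_cases ht : treeDeg (dupont1 k).genDeg t = 1
    · rw [ht]
      simp only [sub_zero, mul_zero, mul_one, sgn_zero, sgn_one, treeLie_of]
      module
    · simp only [zeroForm_eq_zero ht, map_zero, mul_zero, zero_smul, add_zero, neg_zero]
  · intro s t hs ht
    rw [hf, mulOneForm_eq_zero hs ht, map_zero, mul_zero, zero_smul]
  · have zeroForm_e01 : zeroForm k (.of .e01) = 0 := rfl
    rw [hf, mulOneForm_e01_left, zeroForm_e01, map_zero, mul_zero, zero_smul]

theorem sum_smul_treeLie_mem_liePoly (ℓ : Module.Dual k k[X]) (n : ℕ) :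
    ∑ T ∈ trees Face1 n, ℓ (zeroForm k T) • treeLie k (dupont1 k).genDeg T ∈
      liePoly k (dupont1 k).genDeg n 1 := by
  refine Submodule.sum_mem _ fun T hT => ?_
  by_cases h : treeDeg (dupont1 k).genDeg T = 1
  · exact Submodule.smul_mem _ _ (Submodule.subset_span ⟨T, mem_trees.1 hT, h, rfl⟩)
  · rw [zeroForm_eq_zero h, map_zero, zero_smul]
    exact zero_mem _

variable (k) in
/-- The image under `1 ⊗ ℓ` of the `0`-form part of the sum `ψ` over all labelled trees, for a
functional `ℓ` on polynomials. -/
noncomputable def zeroFormSeries : Module.Dual k k[X] →ₗ[k] (mc1Lie k).V 1 where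
  toFun ℓ := lieSeries fun n => ⟨_, sum_smul_treeLie_mem_liePoly ℓ n⟩
  map_add' ℓ ℓ' := lieCoeff_ext fun n => by
    simp only [map_add, lieCoeff_lieSeries, LinearMap.add_apply, add_smul, Finset.sum_add_distrib]
  map_smul' a ℓ := lieCoeff_ext fun n => by
    simp only [map_smul, lieCoeff_lieSeries, LinearMap.smul_apply, smul_assoc, Finset.smul_sum,
      RingHom.id_apply]

theorem lieCoeff_zeroFormSeries (ℓ : Module.Dual k k[X]) (n : ℕ) :
    lieCoeff n (zeroFormSeries k ℓ) =
      ∑ T ∈ trees Face1 n, ℓ (zeroForm k T) • treeLie k (dupont1 k).genDeg T :=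
  lieCoeff_lieSeries _ n

theorem lieCoeff_one_zeroFormSeries (ℓ : Module.Dual k k[X]) :
    lieCoeff 1 (zeroFormSeries k ℓ) =
      ℓ (1 - X) • FreeAlgebra.ι k .v0 + ℓ X • FreeAlgebra.ι k .v1 := by
  rw [lieCoeff_zeroFormSeries, sum_trees_one, Face1.sum_eq]
  change _ + _ + ℓ 0 • _ = _
  rw [map_zero, zero_smul, add_zero]
  rfl

theorem lieCoeff_add_two_zeroFormSeries (ℓ : Module.Dual k k[X]) (n : ℕ) :
    lieCoeff (n + 2) (zeroFormSeries k ℓ) =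
      -gradedComm k _ 0 (FreeAlgebra.ι k .e01)
        (lieCoeff (n + 1) (zeroFormSeries k (ℓ ∘ₗ homotopyPoly k))) := by
  rw [lieCoeff_zeroFormSeries, lieCoeff_zeroFormSeries,
    sum_trees_eq_neg_gradedComm (ℓ := ℓ ∘ₗ homotopyPoly k) fun s t => by
      rw [zeroForm_mul, map_smul, smul_eq_mul, LinearMap.comp_apply]]

variable (k) in
/-- The differential `dλ` of the generator `λ = s ω₀₁^∨` of `mc₁`. -/
noncomputable def dGen01 : (mc1Lie k).V 1 :=
  (dupont1 k).genD .e01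

theorem lieCoeff_dGen01 (n : ℕ) : lieCoeff n (dGen01 k) =
    ∑ T ∈ trees Face1 n, (dupont1 k).treeCoeff .e01 T • treeLie k (dupont1 k).genDeg T :=
  (dupont1 k).lieCoeff_genD .e01 n

theorem lieCoeff_one_dGen01 : lieCoeff 1 (dGen01 k) =
    FreeAlgebra.ι k .v1 - FreeAlgebra.ι k .v0 := by
  have genDeg_v0 : (dupont1 k).genDeg .v0 = 1 := rfl
  have genDeg_v1 : (dupont1 k).genDeg .v1 = 1 := rfl
  rw [lieCoeff_dGen01, sum_trees_one, Face1.sum_eq, treeCoeff_e01_of, treeCoeff_e01_of,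
    treeCoeff_e01_of, genDeg_v0, genDeg_v1]
  simp [basicForm]
  abel

theorem lieCoeff_add_two_dGen01 (n : ℕ) : lieCoeff (n + 2) (dGen01 k) =
    gradedComm k _ 0 (FreeAlgebra.ι k .e01)
      (lieCoeff (n + 1) (zeroFormSeries k (unitIntegral k))) := by
  rw [lieCoeff_dGen01, sum_trees_eq_neg_gradedComm treeCoeff_e01_mul, ← map_neg,
    lieCoeff_zeroFormSeries, ← Finset.sum_neg_distrib]
  simp only [LinearMap.neg_apply, neg_smul, neg_neg]

theorem smul_zeroFormSeries_comp_homotopyPoly (n : ℕ) :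
    ((n + 1 : ℕ) : k) • zeroFormSeries k (lcoeff k (n + 1) ∘ₗ homotopyPoly k) =
      zeroFormSeries k (lcoeff k n) - if n = 0 then zeroFormSeries k (unitIntegral k) else 0 := by
  rw [← map_smul, lcoeff_succ_comp_homotopyPoly, map_sub, apply_ite (zeroFormSeries k), map_zero]

theorem lieCoeff_succ_bracket_gen01 (F : (mc1Lie k).V 1) (n : ℕ) :
    lieCoeff (n + 1) ((mc1Lie k).bracket (zero_add 1) (lieGen k (dupont1 k).genDeg .e01) F) =
      gradedComm k _ 0 (FreeAlgebra.ι k .e01) (lieCoeff n F) :=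
  lieCoeff_succ_bracket_lieGen (deg := (dupont1 k).genDeg) .e01 (zero_add 1) F n

theorem isFlow_zeroFormSeries : (mc1Lie k).IsFlow (lieGen k (dupont1 k).genDeg .e01) (dGen01 k)
    (fun n => zeroFormSeries k (lcoeff k n)) := fun n => by
  refine lieCoeff_ext fun m => ?_
  rw [map_smul, map_sub, apply_ite (lieCoeff m), map_zero]
  match m with
  | 0 => simp only [lieCoeff_zero_left, smul_zero, ite_self, sub_zero]
  | 1 =>
    rw [lieCoeff_one_zeroFormSeries, lieCoeff_succ_bracket_gen01, lieCoeff_zero_left, map_zero,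
      sub_zero]
    rcases n with _ | n
    · rw [if_pos rfl, lieCoeff_one_dGen01]
      simp [coeff_one]
      abel
    · simp [coeff_one, coeff_X]
  | m + 2 =>
    rw [lieCoeff_add_two_zeroFormSeries, lieCoeff_succ_bracket_gen01, lieCoeff_add_two_dGen01,
      smul_neg, ← map_smul, ← map_smul (lieCoeff (m + 1)), smul_zeroFormSeries_comp_homotopyPoly,
      map_sub, map_sub, neg_sub]
    split_ifs
    · rfl
    · simp only [map_zero]

theorem sumsTo_zeroFormSeries :
    (mc1Lie k).SumsTo (fun n => zeroFormSeries k (lcoeff k n)) (zeroFormSeries k (leval 1)) := by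
  intro N
  obtain ⟨K, natDegree_lt⟩ : ∃ K, ∀ m < N, ∀ T ∈ trees Face1 m, (zeroForm k T).natDegree < K :=
    ⟨((Finset.range N).sup fun m => (trees Face1 m).sup fun T => (zeroForm k T).natDegree) + 1,
      fun m hm T hT => Nat.lt_succ_of_le <| Finset.le_sup_of_le (Finset.mem_range.2 hm) <|
        Finset.le_sup (f := fun T => (zeroForm k T).natDegree) hT⟩
  filter_upwards [Filter.eventually_ge_atTop K] with n hn
  refine mem_F_iff.2 fun m hm => ?_
  rw [← map_sum, ← map_sub, lieCoeff_zeroFormSeries]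
  refine Finset.sum_eq_zero fun T hT => ?_
  have eval_eq : (zeroForm k T).eval 1 = ∑ l ∈ Finset.range n, (zeroForm k T).coeff l := by
    rw [eval_eq_sum_range' ((natDegree_lt m hm T hT).trans_le hn)]
    simp only [one_pow, mul_one]
  rw [LinearMap.sub_apply, LinearMap.sum_apply, leval_apply, eval_eq]
  simp only [lcoeff_apply, sub_self, zero_smul]

-- Dupont's homotopy vanishes at the vertices, so only the trees with one leaf contribute there.
theorem lieCoeff_zeroFormSeries_of_comp_eq_zero {ℓ : Module.Dual k k[X]}
    (hℓ : ℓ ∘ₗ homotopyPoly k = 0) (n : ℕ) :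
    lieCoeff n (zeroFormSeries k ℓ) =
      if n = 1 then ℓ (1 - X) • FreeAlgebra.ι k .v0 + ℓ X • FreeAlgebra.ι k .v1 else 0 :=
  match n with
  | 0 => lieCoeff_zero_left _
  | 1 => lieCoeff_one_zeroFormSeries ℓ
  | n + 2 => by
    rw [lieCoeff_add_two_zeroFormSeries, hℓ, map_zero, map_zero, map_zero, neg_zero,
      if_neg (by omega)]

theorem zeroFormSeries_leval_zero :
    zeroFormSeries k (leval 0) = lieGen k (dupont1 k).genDeg .v0 := by
  refine lieCoeff_ext fun n => .trans ?_ (lieCoeff_lieGen (deg := (dupont1 k).genDeg) .v0 n).symm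
  rw [lieCoeff_zeroFormSeries_of_comp_eq_zero (leval_zero_comp_homotopyPoly k)]
  simp

theorem zeroFormSeries_leval_one :
    zeroFormSeries k (leval 1) = lieGen k (dupont1 k).genDeg .v1 := by
  refine lieCoeff_ext fun n => .trans ?_ (lieCoeff_lieGen (deg := (dupont1 k).genDeg) .v1 n).symm
  rw [lieCoeff_zeroFormSeries_of_comp_eq_zero (leval_one_comp_homotopyPoly k)]
  simp

variable (k)

theorem mc1_isGauge : (mc1 k).IsGauge (mc1Gen01 k) (mc1Gen0 k) (mc1Gen1 k) := by
  have d_gen01 : (mc1 k).d (zero_add 1) (mc1Gen01 k) = dGen01 k :=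
    freeDerLie_d_gen (dupont1 k).genDeg (dupont1 k).genD .e01
  have start_eq : zeroFormSeries k (leval 0) = mc1Gen0 k := zeroFormSeries_leval_zero
  have end_eq : zeroFormSeries k (leval 1) = mc1Gen1 k := zeroFormSeries_leval_one
  have lcoeff_zero : lcoeff k 0 = leval 0 := LinearMap.ext coeff_zero_eq_eval_zero
  refine DerLie.isGauge_iff.2 ⟨fun n => zeroFormSeries k (lcoeff k n), ?_, ?_, ?_⟩
  · exact (congrArg _ lcoeff_zero).trans start_eq
  · rw [d_gen01]
    exact isFlow_zeroFormSeries
  · exact end_eq ▸ sumsTo_zeroFormSeries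

theorem mc1_isMaurerCartan_gen0 : (mc1 k).IsMaurerCartan (mc1Gen0 k) :=
  add_eq_zero_iff_eq_neg.2 <| Contraction.d_gen_of_augmentation (c := dupont1 k) (i := .v0) rfl
    (fun a _ => eval_mul (p := TrivSqZeroExt.fst (a : DualNumber k[X])))
    (fun _ => eval_zero) _ _

theorem mc1_isMaurerCartan_gen1 : (mc1 k).IsMaurerCartan (mc1Gen1 k) :=
  add_eq_zero_iff_eq_neg.2 <| Contraction.d_gen_of_augmentation (c := dupont1 k) (i := .v1) rfl
    (fun a _ => eval_mul (p := TrivSqZeroExt.fst (a : DualNumber k[X])))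
    (fun _ => eval_zero) _ _

theorem mc1_isFreeCompleteOn : (mc1 k).IsFreeCompleteOn DerLie.LSGen.deg
    ((mc1 k).lsFamily (mc1Gen0 k) (mc1Gen1 k) (mc1Gen01 k)) := by
  obtain ⟨hcomplete, hfree⟩ := freeLie_isFreeCompleteOn k (dupont1 k).genDeg
  refine ⟨hcomplete, fun M hM y => ?_⟩
  let y' : ∀ i, M.V ((dupont1 k).genDeg i) := fun
    | .v0 => y .a
    | .v1 => y .b
    | .e01 => y .x
  obtain ⟨φ, hφ, hunique⟩ := hfree M hM y'
  refine ⟨φ, fun | .a => hφ .v0 | .b => hφ .v1 | .x => hφ .e01, fun χ hχ => hunique χ ?_⟩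
  exact fun | .v0 => hχ .a | .v1 => hχ .b | .e01 => hχ .x

theorem mc1_isLawrenceSullivan :
    (mc1 k).IsLawrenceSullivan (mc1Gen0 k) (mc1Gen1 k) (mc1Gen01 k) := by
  have hfree := mc1_isFreeCompleteOn k
  have hMC0 := mc1_isMaurerCartan_gen0 k
  have hMC1 := mc1_isMaurerCartan_gen1 k
  have hgauge := mc1_isGauge k
  refine ⟨freeDerLie_isDGLie ?_, hfree, hMC0, hMC1, hgauge⟩
  exact fun
    | .v0 => hMC0.d_d_eq_zero
    | .v1 => hMC1.d_d_eq_zero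
    | .e01 => hgauge.d_d_eq_zero hfree.1 hMC0 hMC1

theorem exists_iso_mc1 (L : DerLie k) (a b : L.V 1) (x : L.V 0)
    (hL : L.IsLawrenceSullivan a b x) :
    ∃ φ : DerLie.Iso (mc1 k) L, φ.f 1 (mc1Gen0 k) = a ∧ φ.f 1 (mc1Gen1 k) = b ∧
      φ.f 0 (mc1Gen01 k) = x := by
  obtain ⟨-, hfree, hMCa, hMCb, hgauge⟩ := hL
  have mc1_free := mc1_isFreeCompleteOn k
  obtain ⟨φ, hφ, -⟩ := mc1_free.2 L.toGradedLie hfree.1 (L.lsFamily a b x)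
  obtain rfl : φ.f 1 (mc1Gen0 k) = a := hφ .a
  obtain rfl : φ.f 1 (mc1Gen1 k) = b := hφ .b
  obtain rfl : φ.f 0 (mc1Gen01 k) = x := hφ .x
  refine ⟨⟨φ, mc1_free.bijective hfree hφ, map_d_of_map_d_lieGen hfree.1 φ ?_⟩, rfl, rfl, rfl⟩
  exact fun
    | .v0 => (mc1_isMaurerCartan_gen0 k).map_d φ hMCa
    | .v1 => (mc1_isMaurerCartan_gen1 k).map_d φ hMCb
    | .e01 => (mc1_isGauge k).map_d hfree.1 φ hgauge

end Interval

section Point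

variable (k : Type u) [Field k]

theorem mc0_isMaurerCartan_gen : (mc0 k).IsMaurerCartan (mc0Gen k) :=
  add_eq_zero_iff_eq_neg.2 <| Contraction.d_gen_of_augmentation (c := dupont0 k) (i := ()) rfl
    (fun _ _ => rfl) (fun _ => rfl) _ _

variable [CharZero k]

theorem mc0_isFreeOnMaurerCartan : (mc0 k).IsFreeOnMaurerCartan (mc0Gen k) :=
  ⟨freeDerLie_isDGLie fun _ => (mc0_isMaurerCartan_gen k).d_d_eq_zero,
    freeLie_isFreeCompleteOn k (dupont0 k).genDeg, mc0_isMaurerCartan_gen k⟩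

theorem exists_iso_mc0 (L : DerLie k) (a : L.V 1) (hL : L.IsFreeOnMaurerCartan a) :
    ∃ φ : DerLie.Iso (mc0 k) L, φ.f 1 (mc0Gen k) = a := by
  obtain ⟨-, hfree, hMC⟩ := hL
  have mc0_free := (mc0_isFreeOnMaurerCartan k).2.1
  obtain ⟨φ, hφ, -⟩ := mc0_free.2 L.toGradedLie hfree.1 fun _ => a
  obtain rfl : φ.f 1 (mc0Gen k) = a := hφ ()
  exact ⟨⟨φ, mc0_free.bijective hfree hφ, map_d_of_map_d_lieGen hfree.1 φ fun _ =>
    (mc0_isMaurerCartan_gen k).map_d φ hMC⟩, rfl⟩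

end Point

end LieMC

theorem proposition5p4 (k : Type u) [Field k] [CharZero k] :
    ((LieMC.mc0 k).IsFreeOnMaurerCartan (LieMC.mc0Gen k) ∧
      ∀ (L : LieMC.DerLie k) (a : L.V 1), L.IsFreeOnMaurerCartan a →
        ∃ φ : LieMC.DerLie.Iso (LieMC.mc0 k) L, φ.f 1 (LieMC.mc0Gen k) = a) ∧
    ((LieMC.mc1 k).IsLawrenceSullivan (LieMC.mc1Gen0 k) (LieMC.mc1Gen1 k) (LieMC.mc1Gen01 k) ∧
      ∀ (L : LieMC.DerLie k) (a b : L.V 1) (x : L.V 0), L.IsLawrenceSullivan a b x →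
        ∃ φ : LieMC.DerLie.Iso (LieMC.mc1 k) L, φ.f 1 (LieMC.mc1Gen0 k) = a ∧
          φ.f 1 (LieMC.mc1Gen1 k) = b ∧ φ.f 0 (LieMC.mc1Gen01 k) = x) :=
  ⟨⟨LieMC.mc0_isFreeOnMaurerCartan k, LieMC.exists_iso_mc0 k⟩,
    LieMC.mc1_isLawrenceSullivan k, LieMC.exists_iso_mc1 k⟩
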